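/- Let $\tilde M$ be a $d$-dimensional smooth manifold without boundary (Hausdorff and paracompact), let $1\le k\le d$, and let $M\subset\tilde M$ be a $k$-dimensional smooth submanifold with Lipschitz kinks. This means that every $p\in M$ admits a slice chart, i.e. a smooth chart $(U,\varphi)$ of $\tilde M$ with $p\in U$, $\varphi(p)=0$ and $\varphi(U\cap M)=S\times\{0\}\subset\mathbb R^k\times\{0\}^{d-k}$ such that either * $0$ is an interior point of $S\subset\mathbb R^k$, or * $S$ coincides near $0$ with the closure of $\Omega:=\operatorname{int}S$, and $0$ is a Lipschitz boundary point of $\Omega$: $0\in\partial\Omega$ and, after a rigid motion of $\mathbb R^k$, there are a ball $B$ centred at the image of $0$ and a Lipschitz function $\gamma:\mathbb R^{k-1}\to\mathbb R$ with $\overline\Omega\cap B=\{y_k\ge\gamma(y_1,\dots,y_{k-1})\}\cap B$ and $\Omega\cap B=\{y_k>\gamma(y_1,\dots,y_{k-1})\}\cap B$. For $x\in M$ let $T_xM\subset T_x\tilde M$ be the subspace of the tangent vectors that annihilate all smooth functions on $\tilde M$ vanishing on $M$; in a slice chart, $T_xM=(d_x\varphi)^{-1}(\mathbb R^k\times\{0\})$,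 also at border points. A $C^2$ Riemannian metric on $M$ is a family $g=(g_x)_{x\in M}$ of symmetric positive definite bilinear forms $g_x$ on $T_xM$ whose coefficients in every slice chart are $C^2$ functions on $S$ up to the border points (twice continuously differentiable relative to $S$; this holds in particular if they extend locally to $C^2$ functions on open subsets of $\mathbb R^k$). Then for every $C^2$ Riemannian metric $g$ on $M$ there exist an open set $O\subset\tilde M$ containing $M$ and a $C^2$ Riemannian metric $\tilde g$ on $O$ that restricts to $g$ on $M$, i.e. $\tilde g_x(u,v)=g_x(u,v)$ for all $x\in M$ and $u,v\in T_xM$. -/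

import Mathlib

open scoped Manifold ContDiff Topology

/-! ### Lipschitz boundary points of open subsets of Euclidean space -/

/-- The epigraph `{y | γ (y') ≤ y_last}` of `γ : ℝⁿ → ℝ`, a subset of `ℝⁿ⁺¹`;
`y'` consists of the first `n` coordinates of `y`. -/
def epigraph {n : ℕ} (γ : EuclideanSpace ℝ (Fin n) → ℝ) :
    Set (EuclideanSpace ℝ (Fin (n + 1))) :=
  {y | γ (WithLp.toLp 2 fun i => y i.castSucc) ≤ y (Fin.last n)}

/-- The strict epigraph `{y | γ (y') < y_last}` of `γ : ℝⁿ → ℝ`. -/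
def strictEpigraph {n : ℕ} (γ : EuclideanSpace ℝ (Fin n) → ℝ) :
    Set (EuclideanSpace ℝ (Fin (n + 1))) :=
  {y | γ (WithLp.toLp 2 fun i => y i.castSucc) < y (Fin.last n)}

/-- `x` is a Lipschitz (that is, `C^{0,1}`) boundary point of the set `Ω` (meant to be open):
up to a rigid motion `R`, near `x` the closure of `Ω` is the epigraph, and `Ω` is the strict
epigraph, of a Lipschitz function. -/
def IsLipschitzBoundaryPoint {n : ℕ} (Ω : Set (EuclideanSpace ℝ (Fin (n + 1))))
    (x : EuclideanSpace ℝ (Fin (n + 1))) : Prop :=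
  x ∈ frontier Ω ∧
  ∃ (R : EuclideanSpace ℝ (Fin (n + 1)) ≃ᵃⁱ[ℝ] EuclideanSpace ℝ (Fin (n + 1)))
    (γ : EuclideanSpace ℝ (Fin n) → ℝ) (δ : ℝ),
    0 < δ ∧ (∃ K, LipschitzWith K γ) ∧
    R '' closure Ω ∩ Metric.ball (R x) δ = epigraph γ ∩ Metric.ball (R x) δ ∧
    R '' Ω ∩ Metric.ball (R x) δ = strictEpigraph γ ∩ Metric.ball (R x) δ

/-! ### Submanifolds with Lipschitz kinks -/

/-- The projection of `ℝᵈ` onto its first `k` coordinates. -/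
noncomputable def sliceProj {k d : ℕ} (hk : k ≤ d) :
    EuclideanSpace ℝ (Fin d) →L[ℝ] EuclideanSpace ℝ (Fin k) :=
  LinearMap.toContinuousLinearMap
    { toFun := fun y => WithLp.toLp 2 fun i => y (Fin.castLE hk i)
      map_add' := fun _ _ => rfl
      map_smul' := fun _ _ => rfl }

section Manifold

variable {d : ℕ} {X : Type*} [TopologicalSpace X] [ChartedSpace (EuclideanSpace ℝ (Fin d)) X]

/-- The image of `U ∩ M` under a chart `φ` with domain `U`, read in `ℝᵏ` by means of the first
`k` coordinates (used for charts that map `U ∩ M` into `ℝᵏ × {0}`). -/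
def sliceImage {k : ℕ} (hk : k ≤ d) (M : Set X)
    (φ : OpenPartialHomeomorph X (EuclideanSpace ℝ (Fin d))) :
    Set (EuclideanSpace ℝ (Fin k)) :=
  (fun x => sliceProj hk (φ x)) '' (φ.source ∩ M)

/-- `φ` is a slice chart of `M`, centred at `p`, that exhibits `M` near `p` as an
`(n+1)`-dimensional submanifold with a Lipschitz kink or without border: `φ` is a chart of the
smooth manifold `X` with `φ p = 0`, it maps `M` into `ℝⁿ⁺¹ × {0}`, and `0` is either an interior
point of the image `S ⊆ ℝⁿ⁺¹` of `M`, or a Lipschitz boundary point of the interior of `S`, in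
which case `S` coincides near `0` with the closure of its interior, so that it is locally a
closed Lipschitz epigraph. -/
structure IsLipschitzSliceChart {n : ℕ} (hn : n + 1 ≤ d) (M : Set X) (p : X)
    (φ : OpenPartialHomeomorph X (EuclideanSpace ℝ (Fin d))) : Prop where
  mem_atlas : φ ∈ IsManifold.maximalAtlas (𝓡 d) ∞ X
  mem_source : p ∈ φ.source
  map_center : φ p = 0
  map_slice : ∀ x ∈ φ.source ∩ M, ∀ i : Fin d, n + 1 ≤ (i : ℕ) → φ x i = 0
  interior_or_border :
    (0 : EuclideanSpace ℝ (Fin (n + 1))) ∈ interior (sliceImage hn M φ) ∨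
    (IsLipschitzBoundaryPoint (interior (sliceImage hn M φ)) 0 ∧
      ∀ᶠ y in 𝓝 (0 : EuclideanSpace ℝ (Fin (n + 1))),
        (y ∈ sliceImage hn M φ ↔ y ∈ closure (interior (sliceImage hn M φ))))

/-- `M` is an `(n+1)`-dimensional smooth submanifold with Lipschitz kinks of `X`. -/
def IsSubmanifoldWithLipschitzKinks {n : ℕ} (hn : n + 1 ≤ d) (M : Set X) : Prop :=
  ∀ p ∈ M, ∃ φ : OpenPartialHomeomorph X (EuclideanSpace ℝ (Fin d)),
    IsLipschitzSliceChart hn M p φ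

/-- The tangent space `T_x M`, as a subspace of `T_x X`: those tangent vectors of `X` which, as
derivations, only depend on the restriction of smooth functions to `M`, that is, which annihilate
all smooth functions vanishing on `M`. In a slice chart `φ` it is `(dφ_x)⁻¹ (ℝᵏ × {0})`, also when
`x` is a border point. -/
noncomputable def tangentSpaceOn (M : Set X) (x : X) : Submodule ℝ (TangentSpace (𝓡 d) x) where
  carrier := {v | ∀ f : X → ℝ, ContMDiff (𝓡 d) 𝓘(ℝ, ℝ) ∞ f → (∀ y ∈ M, f y = 0) →
    mfderiv (𝓡 d) 𝓘(ℝ, ℝ) f x v = 0}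
  add_mem' := fun hu hv f hf h0 => by
    rw [map_add, hu f hf h0, hv f hf h0, add_zero]
  zero_mem' := fun f _ _ => map_zero _
  smul_mem' := fun c v hv f hf h0 => by
    rw [map_smul, hv f hf h0, smul_zero]

/-! ### Riemannian metrics of class `C²` -/

/-- `g` is a `C²` Riemannian metric on the `(n+1)`-dimensional submanifold with Lipschitz kinks
`M`: a symmetric, positive definite bilinear form on every `T_x M`, `x ∈ M`, such that in every
slice chart `φ` it is the pullback of a field `G` of bilinear forms on `ℝⁿ⁺¹` (the matrix of
coefficients of `g` in the chart) which is of class `C²` on the image `S` of `M`, up to the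
border points in `S`. -/
structure IsC2RiemannianMetric {n : ℕ} (hn : n + 1 ≤ d) (M : Set X)
    (g : (x : M) → LinearMap.BilinForm ℝ (tangentSpaceOn (d := d) M (x : X))) : Prop where
  symm : ∀ (x : M) (u v : tangentSpaceOn (d := d) M (x : X)), g x u v = g x v u
  pos : ∀ (x : M) (u : tangentSpaceOn (d := d) M (x : X)), u ≠ 0 → 0 < g x u u
  contDiff : ∀ (p : M) (φ : OpenPartialHomeomorph X (EuclideanSpace ℝ (Fin d))),
    IsLipschitzSliceChart hn M (p : X) φ →
    ∃ G : EuclideanSpace ℝ (Fin (n + 1)) →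
        EuclideanSpace ℝ (Fin (n + 1)) →L[ℝ] EuclideanSpace ℝ (Fin (n + 1)) →L[ℝ] ℝ,
      ContDiffOn ℝ 2 G (sliceImage hn M φ) ∧
      ∀ x : M, (x : X) ∈ φ.source → ∀ u v : tangentSpaceOn (d := d) M (x : X),
        g x u v = G (sliceProj hn (φ x))
          (sliceProj hn (mfderiv (𝓡 d) (𝓡 d) φ (x : X) (u : TangentSpace (𝓡 d) (x : X))))
          (sliceProj hn (mfderiv (𝓡 d) (𝓡 d) φ (x : X) (v : TangentSpace (𝓡 d) (x : X))))

/-- `g` is, over the open set `O` of the smooth manifold `X`, a Riemannian metric of class `C²`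
(a `C²` section of the bundle of bilinear forms on the tangent bundle, symmetric and positive
definite at every point of `O`). -/
structure IsC2RiemannianMetricOn [IsManifold (𝓡 d) ∞ X] (O : Set X)
    (g : (x : X) → TangentSpace (𝓡 d) x →L[ℝ] TangentSpace (𝓡 d) x →L[ℝ] ℝ) : Prop where
  symm : ∀ x ∈ O, ∀ u v : TangentSpace (𝓡 d) x, g x u v = g x v u
  pos : ∀ x ∈ O, ∀ u : TangentSpace (𝓡 d) x, u ≠ 0 → 0 < g x u u
  contMDiffOn : ContMDiffOn (𝓡 d)
    ((𝓡 d).prod 𝓘(ℝ, EuclideanSpace ℝ (Fin d) →L[ℝ] EuclideanSpace ℝ (Fin d) →L[ℝ] ℝ)) 2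
    (fun x => (Bundle.TotalSpace.mk' (EuclideanSpace ℝ (Fin d) →L[ℝ] EuclideanSpace ℝ (Fin d) →L[ℝ] ℝ)
      x (g x) : Bundle.TotalSpace
        (EuclideanSpace ℝ (Fin d) →L[ℝ] EuclideanSpace ℝ (Fin d) →L[ℝ] ℝ)
        (fun x : X => TangentSpace (𝓡 d) x →L[ℝ] TangentSpace (𝓡 d) x →L[ℝ] ℝ))) O

end Manifold

/-!
A metric on `M` extends near each point of `M`, and the local extensions are glued by a partition of
unity: a convex combination of `C²` metrics extending `g` is again such a metric.

*Extension of functions.* The analytic core is `ContDiffWithinAt.exists_extension_of_lipschitz`: a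
function `f` that is `C²`, up to the boundary, on a closed Lipschitz epigraph `K` extends locally to
a `C²` function. Write `K = {τ ≤ 0}` with `τ` Lipschitz and `τ (x + t e) = τ x - t`. The averages
`A t = 3 f(x + t e) - 3 f(x + 2 t e) + f(x + 3 t e)` (`translateAverage`) are `C²` on `{τ < t}`, and
since their coefficients reproduce quadratic polynomials, the averages at two scales below `t` differ
by `o(t²)`, their first derivatives by `o(t)` and their second derivatives by `o(1)`. With scales
`t j = t₀ / 4 ^ j` and cutoffs `η j`, equal to `1` where `τ ≤ t j / 16` and to `0` where
`t j / 8 ≤ τ`, whose `i`-th derivatives are `O((t j) ^ (-i))`, the extension is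
`A (t 0) + ∑ j, η j • (A (t (j + 1)) - A (t j))`. On `K` this telescopes to the limit `f` of the
averages. At any point all cutoffs but one are locally constant, first equal to `1` and then to `0`;
hence the second derivatives of the partial sums telescope up to a single small term, so they are
uniformly Cauchy and the sum is `C²`. The cutoffs are mollifications of functions of `τ`.

*Extension of the metric near a point.* In a slice chart centred at `p ∈ M`, extend the coefficients
of `g`, symmetrize, and add the standard form on the last `d - k` coordinates, where `k = n + 1`. This
restricts to `g`, because vectors tangent to `M` have vanishing last components in the chart. It is
positive definite at the centre, because conversely all vectors of `ℝᵏ × {0}` are tangent to `M` at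
`p` (at a border point, by continuity of derivatives from the interior of the slice), and therefore
near the centre.

*Gluing.* A paracompact manifold need not be `σ`-compact, but its connected components are, so
smooth partitions of unity exist on the intersection of an open set with a component.
-/

-- Norms on spaces of iterated continuous linear maps are not found at the default depth.
set_option maxSynthPendingDepth 3

/-! ### Cutoff functions adapted to a Lipschitz function -/

open MeasureTheory in
/-- Convolution with a function bounded by `1` is bounded by the `L¹` norm of the kernel. -/
theorem norm_convolution_le_of_bounded {E V W : Type*} [NormedAddCommGroup E] [NormedSpace ℝ E]
    [MeasurableSpace E] {μ : Measure E} [NormedAddCommGroup V] [NormedSpace ℝ V]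
    [NormedAddCommGroup W] [NormedSpace ℝ W] (B : V →L[ℝ] ℝ →L[ℝ] W) {f : E → V} {u : E → ℝ}
    (hf : Integrable f μ) (hu : ∀ x, |u x| ≤ 1) (x : E) :
    ‖convolution f u B μ x‖ ≤ ‖B‖ * ∫ t, ‖f t‖ ∂μ := by
  rw [convolution, ← integral_const_mul]
  refine norm_integral_le_of_norm_le (hf.norm.const_mul _) (Filter.Eventually.of_forall fun t => ?_)
  calc ‖B (f t) (u (x - t))‖ ≤ ‖B‖ * ‖f t‖ * ‖u (x - t)‖ := B.le_opNorm₂ _ _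
    _ ≤ ‖B‖ * ‖f t‖ * 1 := by gcongr; exact hu _
    _ = _ := mul_one _

open MeasureTheory in
/-- The case `a = 1` of `exists_contDiff_cutoff`: mollify a clamped affine function of `τ` at a
scale determined by its Lipschitz constant. -/
theorem exists_contDiff_cutoff_one {E : Type*} [NormedAddCommGroup E] [NormedSpace ℝ E]
    [FiniteDimensional ℝ E] (L : NNReal) :
    ∃ C : ℝ, 0 ≤ C ∧ ∀ τ : E → ℝ, LipschitzWith L τ →
      ∃ η : E → ℝ, ContDiff ℝ 2 η ∧ (∀ x, |η x| ≤ 1) ∧ (∀ x, τ x ≤ 1 → η x = 1) ∧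
        (∀ x, 2 ≤ τ x → η x = 0) ∧ (∀ x, ‖fderiv ℝ η x‖ ≤ C) ∧
        ∀ x, ‖fderiv ℝ (fderiv ℝ η) x‖ ≤ C := by
  borelize E
  let μ : Measure E := Measure.addHaar
  -- On a ball of radius `2 * r`, the function `τ` oscillates by at most `1 / 4`.
  let r : ℝ := (8 * (L + 1))⁻¹
  have hr : 0 < r := by positivity
  have hLr : L * (2 * r) ≤ 1 / 4 := by
    have : (L : ℝ) * (2 * r) = (L / (L + 1)) / 4 := by simp only [r]; field_simp; ring
    rw [this]
    have : (L : ℝ) / (L + 1) ≤ 1 := div_le_one_of_le₀ (by linarith) (by positivity)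
    linarith
  let φ : ContDiffBump (0 : E) := ⟨r, 2 * r, hr, by linarith⟩
  let ψ : E → ℝ := φ.normed μ
  have hψc : HasCompactSupport ψ := φ.hasCompactSupport_normed
  have hψ : ContDiff ℝ ∞ ψ := φ.contDiff_normed
  have hψ' : ContDiff ℝ ∞ (fderiv ℝ ψ) := hψ.fderiv_right (by simp)
  have hψ'' : ContDiff ℝ ∞ (fderiv ℝ (fderiv ℝ ψ)) := hψ'.fderiv_right (by simp)
  let B0 : ℝ →L[ℝ] ℝ →L[ℝ] ℝ := ContinuousLinearMap.lsmul ℝ ℝ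
  let B1 := B0.precompL E
  let B2 := B1.precompL E
  have hi0 : Integrable ψ μ := hψ.continuous.integrable_of_hasCompactSupport hψc
  have hi1 : Integrable (fderiv ℝ ψ) μ :=
    hψ'.continuous.integrable_of_hasCompactSupport (hψc.fderiv ℝ)
  have hi2 : Integrable (fderiv ℝ (fderiv ℝ ψ)) μ :=
    hψ''.continuous.integrable_of_hasCompactSupport ((hψc.fderiv ℝ).fderiv ℝ)
  refine ⟨max (‖B1‖ * ∫ t, ‖fderiv ℝ ψ t‖ ∂μ) (‖B2‖ * ∫ t, ‖fderiv ℝ (fderiv ℝ ψ) t‖ ∂μ),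
    le_max_of_le_left (mul_nonneg (norm_nonneg _) (integral_nonneg fun _ => norm_nonneg _)),
    fun τ hτ => ?_⟩
  let u : E → ℝ := fun x => max 0 (min 1 (7 / 2 - 2 * τ x))
  have huc : Continuous u := by
    have := hτ.continuous
    fun_prop
  have hu0 : ∀ x, 0 ≤ u x := fun x => le_max_left _ _
  have hu1 : ∀ x, u x ≤ 1 := fun x => max_le zero_le_one (min_le_left _ _)
  have hu : ∀ x, |u x| ≤ 1 := fun x => abs_le.2 ⟨by linarith [hu0 x], hu1 x⟩
  have hul : LocallyIntegrable u μ := huc.locallyIntegrable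
  have hd1 : ∀ x, HasFDerivAt (convolution ψ u B0 μ) (convolution (fderiv ℝ ψ) u B1 μ x) x :=
    hψc.hasFDerivAt_convolution_left B0 (hψ.of_le (by simp)) hul
  have hd2 : ∀ x, HasFDerivAt (convolution (fderiv ℝ ψ) u B1 μ)
      (convolution (fderiv ℝ (fderiv ℝ ψ)) u B2 μ x) x :=
    (hψc.fderiv ℝ).hasFDerivAt_convolution_left B1 (hψ'.of_le (by simp)) hul
  have he1 : fderiv ℝ (convolution ψ u B0 μ) = convolution (fderiv ℝ ψ) u B1 μ :=
    funext fun x => (hd1 x).fderiv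
  have hball : ∀ x, ∀ y ∈ Metric.ball x φ.rOut, |τ y - τ x| ≤ 1 / 4 := by
    intro x y hy
    have h1 : dist (τ y) (τ x) ≤ L * dist y x := hτ.dist_le_mul y x
    have h2 : dist y x ≤ 2 * r := (Metric.mem_ball.1 hy).le
    rw [Real.dist_eq] at h1
    exact h1.trans ((mul_le_mul_of_nonneg_left h2 L.2).trans hLr)
  have hone : ∀ x, τ x ≤ 5 / 4 → u x = 1 := fun x hx => by
    simp only [u]
    rw [min_eq_left (by linarith), max_eq_right zero_le_one]
  have hzero : ∀ x, 7 / 4 ≤ τ x → u x = 0 := fun x hx => by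
    simp only [u]
    rw [min_eq_right (by linarith), max_eq_left (by linarith)]
  refine ⟨convolution ψ u B0 μ, ?_, fun x => ?_, fun x hx => ?_, fun x hx => ?_, fun x => ?_,
    fun x => ?_⟩
  · exact hψc.contDiff_convolution_left B0 (n := 2) (hψ.of_le (mod_cast le_top)) hul
  · have h1 := norm_convolution_le_of_bounded B0 hi0 hu x
    have h2 : ∫ t, ‖ψ t‖ ∂μ = 1 := by
      rw [← φ.integral_normed (μ := μ)]
      exact integral_congr_ae (Filter.Eventually.of_forall fun t =>
        Real.norm_of_nonneg (φ.nonneg_normed t))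
    rw [h2, mul_one] at h1
    exact h1.trans ContinuousLinearMap.opNorm_lsmul_le
  · have hx1 : u x = 1 := hone x (by linarith)
    rw [← hx1]
    refine φ.normed_convolution_eq_right fun y hy => ?_
    rw [hx1]
    exact hone y (by linarith [(abs_le.1 (hball x y hy)).2])
  · have hx1 : u x = 0 := hzero x (by linarith)
    rw [← hx1]
    refine φ.normed_convolution_eq_right fun y hy => ?_
    rw [hx1]
    exact hzero y (by linarith [(abs_le.1 (hball x y hy)).1])
  · rw [(hd1 x).fderiv]
    exact (norm_convolution_le_of_bounded B1 hi1 hu x).trans (le_max_left _ _)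
  · rw [he1, (hd2 x).fderiv]
    exact (norm_convolution_le_of_bounded B2 hi2 hu x).trans (le_max_right _ _)

/-- Cutoff functions for a Lipschitz function `τ`, equal to `1` where `τ ≤ a` and to `0` where
`2 a ≤ τ`, whose derivatives have the natural size at scale `a`, uniformly in `τ` and `a`. -/
theorem exists_contDiff_cutoff {E : Type*} [NormedAddCommGroup E] [NormedSpace ℝ E]
    [FiniteDimensional ℝ E] (L : NNReal) :
    ∃ C : ℝ, 0 ≤ C ∧ ∀ τ : E → ℝ, LipschitzWith L τ → ∀ a : ℝ, 0 < a →
      ∃ η : E → ℝ, ContDiff ℝ 2 η ∧ (∀ x, |η x| ≤ 1) ∧ (∀ x, τ x ≤ a → η x = 1) ∧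
        (∀ x, 2 * a ≤ τ x → η x = 0) ∧ (∀ x, ‖fderiv ℝ η x‖ ≤ C / a) ∧
        ∀ x, ‖fderiv ℝ (fderiv ℝ η) x‖ ≤ C / a ^ 2 := by
  obtain ⟨C, hC0, hC⟩ := exists_contDiff_cutoff_one (E := E) L
  refine ⟨C, hC0, fun τ hτ a ha => ?_⟩
  have hτa : LipschitzWith L fun x => a⁻¹ * τ (a • x) := by
    refine LipschitzWith.of_dist_le_mul fun x y => ?_
    have h := hτ.dist_le_mul (a • x) (a • y)
    rw [dist_smul₀, Real.norm_of_nonneg ha.le] at h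
    rw [Real.dist_eq] at h ⊢
    rw [← mul_sub, abs_mul, abs_of_pos (inv_pos.2 ha), inv_mul_le_iff₀ ha]
    linarith
  obtain ⟨η, h1, h2, h3, h4, h5, h6⟩ := hC _ hτa
  have hs : ∀ x : E, a • a⁻¹ • x = x := fun x => smul_inv_smul₀ ha.ne' x
  have hn : ‖a⁻¹‖ = a⁻¹ := Real.norm_of_nonneg (inv_pos.2 ha).le
  have hd : fderiv ℝ (fun x => η (a⁻¹ • x)) = fun x => a⁻¹ • fderiv ℝ η (a⁻¹ • x) :=
    funext fun x => fderiv_comp_smul (f := η) a⁻¹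
  refine ⟨fun x => η (a⁻¹ • x), h1.comp (contDiff_const_smul _), fun x => h2 _,
    fun x hx => h3 _ ?_, fun x hx => h4 _ ?_, fun x => ?_, fun x => ?_⟩
  · simp only [hs]
    rw [inv_mul_le_iff₀ ha]
    linarith
  · simp only [hs]
    rw [le_inv_mul_iff₀ ha]
    linarith
  · rw [hd, norm_smul, hn, inv_mul_eq_div]
    exact div_le_div_of_nonneg_right (h5 _) ha.le
  · have hdiff : DifferentiableAt ℝ (fun x => fderiv ℝ η (a⁻¹ • x)) x :=
      ((h1.fderiv_right (m := 1) (by norm_num)).comp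
        (contDiff_const_smul a⁻¹)).differentiable (by simp) x
    rw [hd, fderiv_fun_const_smul hdiff, fderiv_comp_smul (f := fderiv ℝ η), norm_smul, norm_smul, hn]
    calc a⁻¹ * (a⁻¹ * ‖fderiv ℝ (fderiv ℝ η) (a⁻¹ • x)‖) ≤ a⁻¹ * (a⁻¹ * C) := by
          gcongr
          exact h6 _
      _ = C / a ^ 2 := by field_simp

/-! ### Taylor estimates and averages of translates -/

/-- First-order Taylor estimate in terms of the oscillation `κ` of the derivative. -/
theorem norm_taylor_one_le {F : Type*} [NormedAddCommGroup F] [NormedSpace ℝ F]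
    {φ φ' : ℝ → F} {a b κ : ℝ} (hφ : ∀ u ∈ Set.Icc a b, HasDerivWithinAt φ (φ' u) (Set.Icc a b) u)
    (hκ : ∀ u ∈ Set.Icc a b, ‖φ' u - φ' a‖ ≤ κ) {u : ℝ} (hu : u ∈ Set.Icc a b) :
    ‖φ u - φ a - (u - a) • φ' a‖ ≤ κ * (u - a) := by
  have h := norm_image_sub_le_of_norm_deriv_le_segment' (f := fun u => φ u - (u - a) • φ' a)
    (f' := fun u => φ' u - φ' a) (C := κ) (fun x hx => ?_)
    (fun x hx => hκ x (Set.Ico_subset_Icc_self hx)) u hu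
  · simpa [sub_right_comm] using h
  · have := (((hasDerivWithinAt_id x (Set.Icc a b)).sub_const a).smul_const (φ' a))
    simpa using! (hφ x hx).sub this

/-- Second-order Taylor estimate in terms of the oscillation `κ` of the second derivative. -/
theorem norm_taylor_two_le {F : Type*} [NormedAddCommGroup F] [NormedSpace ℝ F]
    {φ φ' φ'' : ℝ → F} {a b κ : ℝ}
    (hφ : ∀ u ∈ Set.Icc a b, HasDerivWithinAt φ (φ' u) (Set.Icc a b) u)
    (hφ' : ∀ u ∈ Set.Icc a b, HasDerivWithinAt φ' (φ'' u) (Set.Icc a b) u)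
    (hκ : ∀ u ∈ Set.Icc a b, ‖φ'' u - φ'' a‖ ≤ κ) {u : ℝ} (hu : u ∈ Set.Icc a b) :
    ‖φ u - φ a - (u - a) • φ' a - ((u - a) ^ 2 / 2) • φ'' a‖ ≤ κ * (b - a) * (u - a) := by
  have hκ0 : 0 ≤ κ := (norm_nonneg _).trans (hκ u hu)
  have h := norm_image_sub_le_of_norm_deriv_le_segment'
    (f := fun u => φ u - (u - a) • φ' a - ((u - a) ^ 2 / 2) • φ'' a)
    (f' := fun u => φ' u - φ' a - (u - a) • φ'' a) (C := κ * (b - a)) (fun x hx => ?_)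
    (fun x hx => (norm_taylor_one_le hφ' hκ (Set.Ico_subset_Icc_self hx)).trans
      (mul_le_mul_of_nonneg_left (by linarith [hx.2]) hκ0)) u hu
  · have e : φ u - φ a - (u - a) • φ' a - ((u - a) ^ 2 / 2) • φ'' a =
      (φ u - (u - a) • φ' a - ((u - a) ^ 2 / 2) • φ'' a) -
      (φ a - (a - a) • φ' a - ((a - a) ^ 2 / 2) • φ'' a) := by
      simp only [sub_self]
      module
    rw [e]
    exact h
  · have h1 := (((hasDerivWithinAt_id x (Set.Icc a b)).sub_const a).smul_const (φ' a))
    have h2 := (((((hasDerivWithinAt_id x (Set.Icc a b)).sub_const a).pow 2).div_const 2).smul_const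
      (φ'' a))
    have h3 := ((hφ x hx).sub h1).sub h2
    convert! h3 using 1
    simp only [id]
    norm_num

/-- The average `3 f(x + t e) - 3 f(x + 2 t e) + f(x + 3 t e)` of translates of `f`. Its
coefficients reproduce quadratic polynomials along `e`, so that it approximates `f x` to second
order as `t → 0`, while it only uses values of `f` at distance at least `t` in direction `e`. -/
def translateAverage {E F : Type*} [AddCommGroup E] [Module ℝ E] [AddCommGroup F] [Module ℝ F]
    (e : E) (t : ℝ) (f : E → F) (x : E) : F :=
  (3 : ℝ) • f (x + t • e) - (3 : ℝ) • f (x + (2 * t) • e) + f (x + (3 * t) • e)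

section TranslateAverage

variable {E F : Type*} [NormedAddCommGroup E] [NormedSpace ℝ E]
  [NormedAddCommGroup F] [NormedSpace ℝ F]

theorem HasFDerivAt.translateAverage {e : E} {t : ℝ} {f : E → F} {f' : E → E →L[ℝ] F} {x : E}
    (h : ∀ s ∈ Set.Icc t (3 * t), HasFDerivAt f (f' (x + s • e)) (x + s • e)) (ht : 0 ≤ t) :
    HasFDerivAt (translateAverage e t f) (translateAverage e t f' x) x := by
  have key : ∀ s ∈ Set.Icc t (3 * t), HasFDerivAt (fun y => f (y + s • e)) (f' (x + s • e)) x :=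
    fun s hs => (hasFDerivAt_comp_add_right (s • e)).2 (h s hs)
  exact (((key t ⟨le_rfl, by linarith⟩).const_smul (3 : ℝ)).sub
    ((key (2 * t) ⟨by linarith, by linarith⟩).const_smul (3 : ℝ))).add
    (key (3 * t) ⟨by linarith, le_rfl⟩)

theorem ContinuousAt.translateAverage {e : E} {t : ℝ} {f : E → F} {x : E}
    (h : ∀ s ∈ Set.Icc t (3 * t), ContinuousAt f (x + s • e)) (ht : 0 ≤ t) :
    ContinuousAt (translateAverage e t f) x := by
  have key : ∀ s ∈ Set.Icc t (3 * t), ContinuousAt (fun y => f (y + s • e)) x := fun s hs =>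
    ContinuousAt.comp (f := fun y => y + s • e) (h s hs) (by fun_prop)
  exact (((key t ⟨le_rfl, by linarith⟩).const_smul (3 : ℝ)).sub
    ((key (2 * t) ⟨by linarith, by linarith⟩).const_smul (3 : ℝ))).add
    (key (3 * t) ⟨by linarith, le_rfl⟩)

theorem tendsto_translateAverage {e : E} {f : E → F} {x : E} {D : Set E} {t : ℕ → ℝ}
    (hf : ContinuousWithinAt f D x) (ht : Filter.Tendsto t Filter.atTop (𝓝 0))
    (hD : ∀ j, ∀ s ∈ Set.Icc (t j) (3 * t j), x + s • e ∈ D) (ht0 : ∀ j, 0 ≤ t j) :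
    Filter.Tendsto (fun j => translateAverage e (t j) f x) Filter.atTop (𝓝 (f x)) := by
  have key : ∀ c : ℝ, 1 ≤ c → c ≤ 3 →
      Filter.Tendsto (fun j => f (x + (c * t j) • e)) Filter.atTop (𝓝 (f x)) := by
    intro c hc1 hc3
    refine hf.tendsto.comp (tendsto_nhdsWithin_iff.2 ⟨?_, Filter.Eventually.of_forall fun j =>
      hD j _ ⟨by nlinarith [ht0 j], by nlinarith [ht0 j]⟩⟩)
    have : Filter.Tendsto (fun j => x + (c * t j) • e) Filter.atTop (𝓝 (x + (c * 0) • e)) :=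
      ((ht.const_mul c).smul_const e).const_add x
    simpa using this
  have h := (((key 1 le_rfl (by norm_num)).const_smul (3 : ℝ)).sub
    ((key 2 (by norm_num) (by norm_num)).const_smul (3 : ℝ))).add (key 3 (by norm_num) le_rfl)
  have e1 : (3 : ℝ) • f x - (3 : ℝ) • f x + f x = f x := by simp
  rw [e1] at h
  simpa only [one_mul] using! h

/-- A bound for the difference of two averages `3 φ(r) - 3 φ(2r) + φ(3r)`, for a function `φ` on
an interval that is within `δ` of a quadratic polynomial. -/
theorem norm_average_sub_average_le {φ : ℝ → F} {s t δ : ℝ} (hs : 0 ≤ s) (hst : s ≤ t) (p q r : F)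
    (h : ∀ u ∈ Set.Icc s (3 * t), ‖φ u - p - (u - s) • q - ((u - s) ^ 2 / 2) • r‖ ≤ δ) :
    ‖((3 : ℝ) • φ s - (3 : ℝ) • φ (2 * s) + φ (3 * s)) -
      ((3 : ℝ) • φ t - (3 : ℝ) • φ (2 * t) + φ (3 * t))‖ ≤ 14 * δ := by
  set R : ℝ → F := fun u => φ u - p - (u - s) • q - ((u - s) ^ 2 / 2) • r with hR
  have e : ((3 : ℝ) • φ s - (3 : ℝ) • φ (2 * s) + φ (3 * s)) -
      ((3 : ℝ) • φ t - (3 : ℝ) • φ (2 * t) + φ (3 * t)) =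
      (3 : ℝ) • R s - (3 : ℝ) • R (2 * s) + R (3 * s) - (3 : ℝ) • R t + (3 : ℝ) • R (2 * t)
        - R (3 * t) := by
    simp only [hR]
    module
  have n3 : ∀ u ∈ Set.Icc s (3 * t), ‖(3 : ℝ) • R u‖ ≤ 3 * δ := fun u hu => by
    rw [norm_smul, Real.norm_of_nonneg (by norm_num)]
    exact mul_le_mul_of_nonneg_left (h u hu) (by norm_num)
  have h1 := n3 s ⟨le_rfl, by linarith⟩
  have h2 := n3 (2 * s) ⟨by linarith, by linarith⟩
  have h3 := h (3 * s) ⟨by linarith, by linarith⟩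
  have h4 := n3 t ⟨hst, by linarith⟩
  have h5 := n3 (2 * t) ⟨by linarith, by linarith⟩
  have h6 := h (3 * t) ⟨by linarith, le_rfl⟩
  rw [e]
  refine (norm_sub_le_of_le (norm_add_le_of_le (norm_sub_le_of_le (norm_add_le_of_le
    (norm_sub_le_of_le h1 h2) h3) h4) h5) h6).trans ?_
  linarith

/-- For a twice differentiable function on a set containing a segment in direction `e`, the
averages at two scales `s ≤ t` differ, along with their derivatives, by the natural powers of `t`
times the oscillation of the second derivative. -/
theorem norm_translateAverage_sub_le {e : E} {D : Set E} {f : E → F} {f' : E → E →L[ℝ] F}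
    {f'' : E → E →L[ℝ] E →L[ℝ] F}
    (hf : ∀ y ∈ D, HasFDerivWithinAt f (f' y) D y)
    (hf' : ∀ y ∈ D, HasFDerivWithinAt f' (f'' y) D y)
    {x : E} {s t κ : ℝ} (hs : 0 ≤ s) (hst : s ≤ t)
    (hD : ∀ u ∈ Set.Icc s (3 * t), x + u • e ∈ D)
    (hκ : ∀ u ∈ Set.Icc s (3 * t), ‖f'' (x + u • e) - f'' (x + s • e)‖ ≤ κ) :
    ‖translateAverage e s f x - translateAverage e t f x‖ ≤ 14 * (κ * (3 * t * ‖e‖) ^ 2) ∧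
    ‖translateAverage e s f' x - translateAverage e t f' x‖ ≤ 14 * (κ * (3 * t * ‖e‖)) ∧
    ‖translateAverage e s f'' x - translateAverage e t f'' x‖ ≤ 14 * κ := by
  have hs0 : s ∈ Set.Icc s (3 * t) := ⟨le_rfl, by linarith⟩
  have hκ0 : 0 ≤ κ := (norm_nonneg _).trans (hκ s hs0)
  have hline : ∀ u, HasDerivWithinAt (fun u : ℝ => x + u • e) e (Set.Icc s (3 * t)) u := fun u => by
    simpa using ((hasDerivWithinAt_id u (Set.Icc s (3 * t))).smul_const e).const_add x
  have hd : ∀ u ∈ Set.Icc s (3 * t), HasDerivWithinAt (fun u : ℝ => f (x + u • e))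
      (f' (x + u • e) e) (Set.Icc s (3 * t)) u := fun u hu =>
    (hf _ (hD u hu)).comp_hasDerivWithinAt u (hline u) hD
  have hd' : ∀ u ∈ Set.Icc s (3 * t), HasDerivWithinAt (fun u : ℝ => f' (x + u • e))
      (f'' (x + u • e) e) (Set.Icc s (3 * t)) u := fun u hu =>
    (hf' _ (hD u hu)).comp_hasDerivWithinAt u (hline u) hD
  have hd'' : ∀ u ∈ Set.Icc s (3 * t), HasDerivWithinAt (fun u : ℝ => f' (x + u • e) e)
      (f'' (x + u • e) e e) (Set.Icc s (3 * t)) u := fun u hu => by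
    simpa using (hd' u hu).clm_apply (hasDerivWithinAt_const u _ e)
  have hκ1 : ∀ u ∈ Set.Icc s (3 * t), ‖f'' (x + u • e) e - f'' (x + s • e) e‖ ≤ κ * ‖e‖ :=
    fun u hu => by
      rw [← sub_apply]
      exact ((f'' (x + u • e) - f'' (x + s • e)).le_opNorm e).trans
        (mul_le_mul_of_nonneg_right (hκ u hu) (norm_nonneg _))
  have hκ2 : ∀ u ∈ Set.Icc s (3 * t), ‖f'' (x + u • e) e e - f'' (x + s • e) e e‖ ≤
      κ * ‖e‖ * ‖e‖ := fun u hu => by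
    rw [← sub_apply]
    exact ((f'' (x + u • e) e - f'' (x + s • e) e).le_opNorm e).trans
      (mul_le_mul_of_nonneg_right (hκ1 u hu) (norm_nonneg _))
  have hn := norm_nonneg e
  have ht : 0 ≤ t := hs.trans hst
  refine ⟨?_, ?_, ?_⟩
  · refine norm_average_sub_average_le (φ := fun u => f (x + u • e)) hs hst (f (x + s • e))
      (f' (x + s • e) e) (f'' (x + s • e) e e) fun u hu => ?_
    refine (norm_taylor_two_le hd hd'' hκ2 hu).trans ?_
    calc κ * ‖e‖ * ‖e‖ * (3 * t - s) * (u - s) ≤ κ * ‖e‖ * ‖e‖ * (3 * t) * (3 * t) := by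
          have := hu.2
          have := hu.1
          gcongr
          all_goals first | positivity | linarith
      _ = _ := by ring
  · refine norm_average_sub_average_le (φ := fun u => f' (x + u • e)) hs hst (f' (x + s • e))
      (f'' (x + s • e) e) 0 fun u hu => ?_
    rw [smul_zero, sub_zero]
    refine (norm_taylor_one_le hd' hκ1 hu).trans ?_
    calc κ * ‖e‖ * (u - s) ≤ κ * ‖e‖ * (3 * t) := by
          have := hu.2
          gcongr
          linarith
      _ = _ := by ring
  · refine norm_average_sub_average_le (φ := fun u => f'' (x + u • e)) hs hst (f'' (x + s • e))
      0 0 fun u hu => ?_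
    rw [smul_zero, smul_zero, sub_zero, sub_zero]
    exact hκ u hu

end TranslateAverage

/-! ### Products with cutoffs and limits of `C²` functions -/

/-- Leibniz rule up to second order for a product `η • Δ` with a cutoff `η`, where `Δ` is only
assumed to be twice differentiable away from the zero set of `η`. -/
theorem exists_deriv_cutoff_smul {E F : Type*} [NormedAddCommGroup E] [NormedSpace ℝ E]
    [NormedAddCommGroup F] [NormedSpace ℝ F] {s U : Set E} {η : E → ℝ} {Δ : E → F}
    {Δ' : E → E →L[ℝ] F} {Δ'' : E → E →L[ℝ] E →L[ℝ] F} (hη : ContDiff ℝ 2 η)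
    (hη1 : ∀ x, |η x| ≤ 1) (hcover : ∀ x ∈ s, x ∈ U ∨ η =ᶠ[𝓝 x] 0)
    (hΔ : ∀ x ∈ s ∩ U, HasFDerivAt Δ (Δ' x) x) (hΔ' : ∀ x ∈ s ∩ U, HasFDerivAt Δ' (Δ'' x) x)
    (hΔ'' : ∀ x ∈ s ∩ U, ContinuousAt Δ'' x) :
    ∃ (T' : E → E →L[ℝ] F) (T'' : E → E →L[ℝ] E →L[ℝ] F),
      (∀ x ∈ s, HasFDerivAt (fun x => η x • Δ x) (T' x) x) ∧
      (∀ x ∈ s, HasFDerivAt T' (T'' x) x) ∧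
      (∀ x ∈ s, ContinuousAt T'' x) ∧
      (∀ x, η =ᶠ[𝓝 x] 1 → T' x = Δ' x ∧ T'' x = Δ'' x) ∧
      (∀ x, η =ᶠ[𝓝 x] 0 → T'' x = 0) ∧
      ∀ x, ‖T'' x‖ ≤ ‖Δ'' x‖ +
        (1 + ‖ContinuousLinearMap.smulRightL ℝ E F‖) * (‖fderiv ℝ η x‖ * ‖Δ' x‖) +
        ‖ContinuousLinearMap.smulRightL ℝ E F‖ * (‖fderiv ℝ (fderiv ℝ η) x‖ * ‖Δ x‖) := by
  set B := ContinuousLinearMap.smulRightL ℝ E F with hB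
  have hη' : ContDiff ℝ 1 (fderiv ℝ η) := hη.fderiv_right (by norm_num)
  have hη'' : ContDiff ℝ 0 (fderiv ℝ (fderiv ℝ η)) := hη'.fderiv_right (by norm_num)
  have hd : ∀ x, HasFDerivAt η (fderiv ℝ η x) x := fun x =>
    (hη.differentiable (by norm_num) x).hasFDerivAt
  have hd' : ∀ x, HasFDerivAt (fderiv ℝ η) (fderiv ℝ (fderiv ℝ η) x) x := fun x =>
    (hη'.differentiable (by norm_num) x).hasFDerivAt
  have hconst : ∀ (c : ℝ) (x : E), η =ᶠ[𝓝 x] (fun _ => c) →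
      η x = c ∧ fderiv ℝ η x = 0 ∧ fderiv ℝ (fderiv ℝ η) x = 0 := by
    intro c x hx
    have h1 : fderiv ℝ η =ᶠ[𝓝 x] fun _ => 0 := by
      have := hx.fderiv (𝕜 := ℝ)
      simpa only [fderiv_fun_const] using! this
    refine ⟨hx.eq_of_nhds, h1.eq_of_nhds, ?_⟩
    rw [h1.fderiv_eq, fderiv_fun_const]
    rfl
  let T' : E → E →L[ℝ] F := fun x => η x • Δ' x + B (fderiv ℝ η x) (Δ x)
  let T'' : E → E →L[ℝ] E →L[ℝ] F := fun x =>
    (η x • Δ'' x + (fderiv ℝ η x).smulRight (Δ' x)) +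
      (B.precompR E (fderiv ℝ η x) (Δ' x) + B.precompL E (fderiv ℝ (fderiv ℝ η) x) (Δ x))
  have hT'0 : ∀ x, η =ᶠ[𝓝 x] 0 → T' x = 0 := fun x hx => by
    obtain ⟨h0, h1, -⟩ := hconst 0 x hx
    simp [T', h0, h1]
  have hT''0 : ∀ x, η =ᶠ[𝓝 x] 0 → T'' x = 0 := fun x hx => by
    obtain ⟨h0, h1, h2⟩ := hconst 0 x hx
    simp [T'', h0, h1, h2]
  refine ⟨T', T'', fun x hx => ?_, fun x hx => ?_, fun x hx => ?_, fun x hx => ?_, hT''0,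
    fun x => ?_⟩
  · rcases hcover x hx with hU | h0
    · exact (hd x).smul (hΔ x ⟨hx, hU⟩)
    · rw [hT'0 x h0]
      refine (hasFDerivAt_const (0 : F) x).congr_of_eventuallyEq ?_
      filter_upwards [h0] with y hy
      simp [hy]
  · rcases hcover x hx with hU | h0
    · exact ((hd x).smul (hΔ' x ⟨hx, hU⟩)).add
        (B.hasFDerivAt_of_bilinear (hd' x) (hΔ x ⟨hx, hU⟩))
    · rw [hT''0 x h0]
      refine (hasFDerivAt_const (0 : E →L[ℝ] F) x).congr_of_eventuallyEq ?_
      filter_upwards [h0.eventuallyEq_nhds] with y hy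
      exact hT'0 y hy
  · rcases hcover x hx with hU | h0
    · have c0 : ContinuousAt Δ x := (hΔ x ⟨hx, hU⟩).continuousAt
      have c1 : ContinuousAt Δ' x := (hΔ' x ⟨hx, hU⟩).continuousAt
      have c2 : ContinuousAt Δ'' x := hΔ'' x ⟨hx, hU⟩
      have e0 : ContinuousAt η x := hη.continuous.continuousAt
      have e1 : ContinuousAt (fderiv ℝ η) x := hη'.continuous.continuousAt
      have e2 : ContinuousAt (fderiv ℝ (fderiv ℝ η)) x := hη''.continuous.continuousAt
      have s1 : ContinuousAt (fun x => (fderiv ℝ η x).smulRight (Δ' x)) x :=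
        (((ContinuousLinearMap.smulRightL ℝ E (E →L[ℝ] F)).continuous.continuousAt.comp e1).clm_apply
          c1)
      have s2 : ContinuousAt (fun x => B.precompR E (fderiv ℝ η x) (Δ' x)) x :=
        (((B.precompR E).continuous.continuousAt.comp e1).clm_apply c1)
      have s3 : ContinuousAt (fun x => B.precompL E (fderiv ℝ (fderiv ℝ η) x) (Δ x)) x :=
        (((B.precompL E).continuous.continuousAt.comp e2).clm_apply c0)
      exact ((e0.smul c2).add s1).add (s2.add s3)
    · refine (continuousAt_const (y := (0 : E →L[ℝ] E →L[ℝ] F))).congr ?_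
      filter_upwards [h0.eventuallyEq_nhds] with y hy
      exact (hT''0 y hy).symm
  · obtain ⟨h0, h1, h2⟩ := hconst 1 x hx
    constructor
    · simp [T', h0, h1]
    · simp [T'', h0, h1, h2]
  · have n1 : ‖η x • Δ'' x‖ ≤ ‖Δ'' x‖ := by
      rw [norm_smul]
      exact mul_le_of_le_one_left (norm_nonneg _) (hη1 x)
    have n2 : ‖(fderiv ℝ η x).smulRight (Δ' x)‖ ≤ ‖fderiv ℝ η x‖ * ‖Δ' x‖ :=
      (ContinuousLinearMap.norm_smulRight_apply _ _).le
    have n3 : ‖B.precompR E (fderiv ℝ η x) (Δ' x)‖ ≤ ‖B‖ * (‖fderiv ℝ η x‖ * ‖Δ' x‖) := by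
      refine ((B.precompR E).le_opNorm₂ _ _).trans ?_
      rw [mul_assoc]
      exact mul_le_mul_of_nonneg_right (B.norm_precompR_le E) (by positivity)
    have n4 : ‖B.precompL E (fderiv ℝ (fderiv ℝ η) x) (Δ x)‖ ≤
        ‖B‖ * (‖fderiv ℝ (fderiv ℝ η) x‖ * ‖Δ x‖) := by
      refine ((B.precompL E).le_opNorm₂ _ _).trans ?_
      rw [mul_assoc]
      exact mul_le_mul_of_nonneg_right (B.norm_precompL_le E) (by positivity)
    refine (norm_add_le_of_le (norm_add_le_of_le n1 n2) (norm_add_le_of_le n3 n4)).trans ?_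
    linarith

/-- A uniformly Cauchy sequence of maps into a complete space has a uniform limit. -/
theorem UniformCauchySeqOn.exists_tendstoUniformlyOn {α V : Type*} [UniformSpace V] [CompleteSpace V]
    [Nonempty V] {u : ℕ → α → V} {s : Set α} (hu : UniformCauchySeqOn u Filter.atTop s) :
    ∃ g : α → V, TendstoUniformlyOn u g Filter.atTop s := by
  have : ∀ x, ∃ y, x ∈ s → Filter.Tendsto (fun n => u n x) Filter.atTop (𝓝 y) := by
    intro x
    by_cases hx : x ∈ s
    · obtain ⟨y, hy⟩ := cauchySeq_tendsto_of_complete (hu.cauchySeq hx)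
      exact ⟨y, fun _ => hy⟩
    · exact ⟨Classical.arbitrary V, fun h => absurd h hx⟩
  choose g hg using this
  exact ⟨g, hu.tendstoUniformlyOn_of_tendsto fun x hx => hg x hx⟩

/-- A sequence of `C²` functions on a ball whose second derivatives are uniformly Cauchy, and
which converges together with its derivatives at the centre, has a `C²` limit. -/
theorem exists_contDiffOn_two_of_uniformCauchySeqOn {E F : Type*} [NormedAddCommGroup E]
    [NormedSpace ℝ E] [NormedAddCommGroup F] [NormedSpace ℝ F] [CompleteSpace F] {x₀ : E} {ρ : ℝ}
    {f : ℕ → E → F} {f' : ℕ → E → E →L[ℝ] F} {f'' : ℕ → E → E →L[ℝ] E →L[ℝ] F}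
    (hf : ∀ n, ∀ x ∈ Metric.ball x₀ ρ, HasFDerivAt (f n) (f' n x) x)
    (hf' : ∀ n, ∀ x ∈ Metric.ball x₀ ρ, HasFDerivAt (f' n) (f'' n x) x)
    (hf'' : ∀ n, ContinuousOn (f'' n) (Metric.ball x₀ ρ))
    (hC : UniformCauchySeqOn f'' Filter.atTop (Metric.ball x₀ ρ))
    (h0 : ∃ y, Filter.Tendsto (fun n => f n x₀) Filter.atTop (𝓝 y))
    (h0' : ∃ y, Filter.Tendsto (fun n => f' n x₀) Filter.atTop (𝓝 y)) :
    ∃ g : E → F, ContDiffOn ℝ 2 g (Metric.ball x₀ ρ) ∧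
      ∀ x ∈ Metric.ball x₀ ρ, Filter.Tendsto (fun n => f n x) Filter.atTop (𝓝 (g x)) := by
  have hC' := uniformCauchySeqOn_ball_of_fderiv hC hf' h0'.choose_spec.cauchy_map
  have hC0 := uniformCauchySeqOn_ball_of_fderiv hC' hf h0.choose_spec.cauchy_map
  obtain ⟨g, hg⟩ := hC0.exists_tendstoUniformlyOn
  obtain ⟨g', hg'⟩ := hC'.exists_tendstoUniformlyOn
  obtain ⟨g'', hg''⟩ := hC.exists_tendstoUniformlyOn
  have hd : ∀ x ∈ Metric.ball x₀ ρ, HasFDerivAt g (g' x) x := fun x hx =>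
    hasFDerivAt_of_tendstoUniformlyOn Metric.isOpen_ball hg' hf (fun y hy => hg.tendsto_at hy) hx
  have hd' : ∀ x ∈ Metric.ball x₀ ρ, HasFDerivAt g' (g'' x) x := fun x hx =>
    hasFDerivAt_of_tendstoUniformlyOn Metric.isOpen_ball hg'' hf' (fun y hy => hg'.tendsto_at hy) hx
  have hcont : ContinuousOn g'' (Metric.ball x₀ ρ) :=
    hg''.continuousOn (Filter.Eventually.of_forall hf'').frequently
  have hc1 : ContDiffOn ℝ 1 g' (Metric.ball x₀ ρ) := by
    rw [show (1 : WithTop ℕ∞) = 0 + 1 by norm_num,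
      contDiffOn_succ_iff_fderiv_of_isOpen Metric.isOpen_ball]
    refine ⟨fun x hx => (hd' x hx).differentiableAt.differentiableWithinAt, by simp, ?_⟩
    rw [contDiffOn_zero]
    exact hcont.congr fun x hx => (hd' x hx).fderiv
  refine ⟨g, ?_, fun x hx => hg.tendsto_at hx⟩
  rw [show (2 : WithTop ℕ∞) = 1 + 1 by norm_num,
    contDiffOn_succ_iff_fderiv_of_isOpen Metric.isOpen_ball]
  exact ⟨fun x hx => (hd x hx).differentiableAt.differentiableWithinAt, by simp,
    hc1.congr fun x hx => (hd x hx).fderiv⟩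

/-! ### Extension of functions from Lipschitz epigraphs -/

/-- A function that is `C²` within `K` at `x₀ ∈ K` has two successive derivatives within `K` on a
whole neighbourhood of `x₀` in `K`, the second one being continuous. -/
theorem ContDiffWithinAt.exists_two_derivs {E F : Type*} [NormedAddCommGroup E] [NormedSpace ℝ E]
    [NormedAddCommGroup F] [NormedSpace ℝ F] {f : E → F} {K : Set E} {x₀ : E}
    (hf : ContDiffWithinAt ℝ 2 f K x₀) (hx₀ : x₀ ∈ K) :
    ∃ r > 0, ∃ (f' : E → E →L[ℝ] F) (f'' : E → E →L[ℝ] E →L[ℝ] F),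
      (∀ y ∈ K ∩ Metric.closedBall x₀ r,
        HasFDerivWithinAt f (f' y) (K ∩ Metric.closedBall x₀ r) y) ∧
      (∀ y ∈ K ∩ Metric.closedBall x₀ r,
        HasFDerivWithinAt f' (f'' y) (K ∩ Metric.closedBall x₀ r) y) ∧
      ContinuousOn f'' (K ∩ Metric.closedBall x₀ r) := by
  rw [show (2 : WithTop ℕ∞) = 1 + 1 by norm_num,
    contDiffWithinAt_succ_iff_hasFDerivWithinAt (by simp)] at hf
  obtain ⟨u, hu, -, f', hf', hc⟩ := hf
  rw [show (1 : WithTop ℕ∞) = 0 + 1 by norm_num,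
    contDiffWithinAt_succ_iff_hasFDerivWithinAt (by simp)] at hc
  obtain ⟨v, hv, -, f'', hf'', hc⟩ := hc
  rw [Set.insert_eq_of_mem hx₀] at hu
  have hxu : x₀ ∈ u := mem_of_mem_nhdsWithin hx₀ hu
  rw [Set.insert_eq_of_mem hxu] at hv
  have hxv : x₀ ∈ v := mem_of_mem_nhdsWithin hxu hv
  rw [contDiffWithinAt_zero hxv] at hc
  obtain ⟨w, hw, hcw⟩ := hc
  have hvK : v ∈ 𝓝[K] x₀ := nhdsWithin_le_of_mem hu hv
  have hwK : w ∈ 𝓝[K] x₀ := nhdsWithin_le_of_mem hvK hw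
  obtain ⟨r, hr, hsub⟩ := (nhdsWithin_hasBasis Metric.nhds_basis_closedBall K).mem_iff.1
    (Filter.inter_mem hu (Filter.inter_mem hvK hwK))
  rw [Set.inter_comm] at hsub
  exact ⟨r, hr, f', f'', fun y hy => (hf' y (hsub hy).1).mono fun z hz => (hsub hz).1,
    fun y hy => (hf'' y (hsub hy).2.1).mono fun z hz => (hsub hz).2.1,
    hcw.mono fun z hz => (hsub hz).2⟩

/-- Suppose that the terms of a series are increments of a sequence `A` as long as `a n` exceeds
`θ`, and vanish after the first index with `a n ≤ θ`. Then at most one term is neither of the two, and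
the sums over blocks are controlled by the increments of `A` and by single terms. -/
theorem norm_sum_Ico_le_of_telescoping {V : Type*} [NormedAddCommGroup V] {T A : ℕ → V} {M : ℕ}
    {ε θ : ℝ} {a : ℕ → ℝ} (hε : 0 ≤ ε) (ha : ∀ n, a (n + 1) ≤ a n)
    (htel : ∀ n, M ≤ n → θ < a n → T n = A (n + 1) - A n)
    (hA : ∀ n, M ≤ n → θ < a n → ‖A (n + 1) - A M‖ ≤ ε)
    (hT : ∀ n, M ≤ n → ‖T n‖ ≤ ε)
    (hzero : ∀ n, a n ≤ θ → T (n + 1) = 0) (N : ℕ) (hN : M ≤ N) :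
    ‖∑ n ∈ Finset.Ico M N, T n‖ ≤ 2 * ε := by
  have key : ((∑ n ∈ Finset.Ico M N, T n = A N - A M) ∧ ‖A N - A M‖ ≤ ε) ∨
      (∃ m, m + 1 = N ∧ a m ≤ θ ∧ ‖∑ n ∈ Finset.Ico M N, T n‖ ≤ 2 * ε) := by
    induction N, hN using Nat.le_induction with
    | base => left; simpa using hε
    | succ n hn ih =>
      rw [Finset.sum_Ico_succ_top hn]
      rcases ih with ⟨h1, h2⟩ | ⟨m, rfl, h1, h2⟩
      · by_cases hθ : θ < a n
        · left
          refine ⟨?_, hA n hn hθ⟩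
          rw [h1, htel n hn hθ]
          abel
        · right
          refine ⟨n, rfl, not_lt.1 hθ, ?_⟩
          rw [h1]
          exact (norm_add_le_of_le h2 (hT n hn)).trans (by linarith)
      · right
        refine ⟨m + 1, rfl, (ha m).trans h1, ?_⟩
        rw [hzero m h1, add_zero]
        exact h2
  rcases key with ⟨h1, h2⟩ | ⟨_, _, _, h⟩
  · rw [h1]
    linarith
  · exact h

/-- **Extension of `C²` functions from closed Lipschitz epigraphs.** Let `K = {τ ≤ 0}`, where `τ`
is Lipschitz and decreases at unit speed in the direction `e`. A function that is `C²` on `K`, up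
to the boundary, near `x₀ ∈ K` agrees on `K`, near `x₀`, with a function that is `C²` around
`x₀`. -/
theorem ContDiffWithinAt.exists_extension_of_lipschitz {E F : Type*} [NormedAddCommGroup E]
    [NormedSpace ℝ E] [FiniteDimensional ℝ E] [NormedAddCommGroup F] [NormedSpace ℝ F]
    [CompleteSpace F] {τ : E → ℝ} {L : NNReal} (hτL : LipschitzWith L τ) {e : E}
    (hτe : ∀ x (t : ℝ), τ (x + t • e) = τ x - t) {f : E → F} {x₀ : E} (hx₀ : τ x₀ ≤ 0)
    (hf : ContDiffWithinAt ℝ 2 f {x | τ x ≤ 0} x₀) :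
    ∃ g : E → F, ContDiffAt ℝ 2 g x₀ ∧ ∀ᶠ x in 𝓝 x₀, τ x ≤ 0 → g x = f x := by
  have : ProperSpace E := FiniteDimensional.proper_real E
  obtain ⟨r, hr, f', f'', hf', hf'', hcont⟩ := hf.exists_two_derivs hx₀
  set D : Set E := {x | τ x ≤ 0} ∩ Metric.closedBall x₀ r with hD
  have hτc : Continuous τ := hτL.continuous
  have hDcomp : IsCompact D :=
    (isCompact_closedBall x₀ r).inter_left (isClosed_le hτc continuous_const)
  have hunif := hDcomp.uniformContinuousOn_of_continuous hcont
  have hne : 0 ≤ ‖e‖ := norm_nonneg e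
  -- The scales `t j` and the radius `ρ` are such that all the translates involved stay in `D`.
  set t0 : ℝ := r / (8 * (‖e‖ + 1)) with ht0
  have ht0pos : 0 < t0 := by positivity
  have ht0e : 3 * t0 * ‖e‖ < r / 2 := by
    have h1 : t0 * (‖e‖ + 1) = r / 8 := by rw [ht0]; field_simp
    nlinarith
  obtain ⟨ρ, hρ, hρr, hρτ⟩ : ∃ ρ > 0, ρ ≤ r / 2 ∧ ∀ x ∈ Metric.ball x₀ ρ, τ x < t0 := by
    have h : ∀ᶠ x in 𝓝 x₀, τ x < t0 :=
      hτc.continuousAt.eventually_lt_const (hx₀.trans_lt ht0pos)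
    obtain ⟨ρ, hρ, h⟩ := Metric.eventually_nhds_iff_ball.1 h
    exact ⟨min ρ (r / 2), lt_min hρ (by linarith), min_le_right _ _,
      fun x hx => h x (Metric.ball_subset_ball (min_le_left _ _) hx)⟩
  set t : ℕ → ℝ := fun j => t0 / 4 ^ j with ht
  have htpos : ∀ j, 0 < t j := fun j => by positivity
  have htsucc : ∀ j, t (j + 1) = t j / 4 := fun j => by
    simp only [ht, pow_succ]
    field_simp
  have htanti : Antitone t := antitone_nat_of_succ_le fun j => by
    rw [htsucc]
    linarith [htpos j]
  have htle : ∀ j, t j ≤ t0 := fun j => by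
    have := htanti (Nat.zero_le j)
    simpa [ht] using this
  have htlim : Filter.Tendsto t Filter.atTop (𝓝 0) := by
    have h := (tendsto_pow_atTop_nhds_zero_of_lt_one (r := (1 / 4 : ℝ)) (by norm_num)
      (by norm_num)).const_mul t0
    rw [mul_zero] at h
    refine h.congr fun j => ?_
    simp only [ht, one_div, inv_pow]
    rfl
  have hclose : ∀ x ∈ Metric.ball x₀ ρ, ∀ u : ℝ, 0 ≤ u → u ≤ 3 * t0 →
      x + u • e ∈ Metric.ball x₀ r := by
    intro x hx u hu hu'
    rw [mem_ball_iff_norm] at hx ⊢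
    calc ‖x + u • e - x₀‖ = ‖(x - x₀) + u • e‖ := by congr 1; abel
      _ ≤ ‖x - x₀‖ + ‖u • e‖ := norm_add_le _ _
      _ < r := by
        rw [norm_smul, Real.norm_of_nonneg hu]
        nlinarith
  have hmem : ∀ x ∈ Metric.ball x₀ ρ, ∀ u : ℝ, 0 ≤ u → τ x ≤ u → u ≤ 3 * t0 → x + u • e ∈ D :=
    fun x hx u hu hτu hu' => ⟨by simp only [Set.mem_ofPred_eq, hτe]; linarith,
      Metric.ball_subset_closedBall (hclose x hx u hu hu')⟩
  have hmem' : ∀ x ∈ Metric.ball x₀ ρ, ∀ u : ℝ, 0 ≤ u → τ x < u → u ≤ 3 * t0 →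
      D ∈ 𝓝 (x + u • e) := fun x hx u hu hτu hu' =>
    Filter.inter_mem (Filter.mem_of_superset ((isOpen_lt hτc continuous_const).mem_nhds
      (show τ (x + u • e) < 0 by rw [hτe]; linarith)) fun y (hy : τ y < 0) => hy.le)
      (Filter.mem_of_superset (Metric.isOpen_ball.mem_nhds (hclose x hx u hu hu'))
        Metric.ball_subset_closedBall)
  -- The averages at scale `t j` are twice differentiable where `τ < t j`.
  have hA : ∀ j, ∀ x ∈ Metric.ball x₀ ρ, τ x < t j →
      HasFDerivAt (translateAverage e (t j) f) (translateAverage e (t j) f' x) x ∧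
      HasFDerivAt (translateAverage e (t j) f') (translateAverage e (t j) f'' x) x ∧
      ContinuousAt (translateAverage e (t j) f'') x := by
    intro j x hx hτx
    have h : ∀ s ∈ Set.Icc (t j) (3 * t j), D ∈ 𝓝 (x + s • e) := fun s hs =>
      hmem' x hx s ((htpos j).le.trans hs.1) (hτx.trans_le hs.1)
        (hs.2.trans (by linarith [htle j]))
    exact ⟨HasFDerivAt.translateAverage (fun s hs => (hf' _ (mem_of_mem_nhds (h s hs))).hasFDerivAt
        (h s hs)) (htpos j).le,
      HasFDerivAt.translateAverage (fun s hs => (hf'' _ (mem_of_mem_nhds (h s hs))).hasFDerivAt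
        (h s hs)) (htpos j).le,
      ContinuousAt.translateAverage (fun s hs => hcont.continuousAt (h s hs)) (htpos j).le⟩
  obtain ⟨C, hC0, hcut⟩ := exists_contDiff_cutoff (E := E) L
  choose η hη hη1 hηone hηzero hηd hηd' using fun j => hcut τ hτL (t j / 16) (by linarith [htpos j])
  have hηone' : ∀ j x, τ x < t j / 16 → η j =ᶠ[𝓝 x] 1 := fun j x hx => by
    filter_upwards [(isOpen_lt hτc continuous_const).mem_nhds hx] with y hy
    exact hηone j y (le_of_lt hy)
  have hηzero' : ∀ j x, t j / 8 < τ x → η j =ᶠ[𝓝 x] 0 := fun j x hx => by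
    filter_upwards [(isOpen_lt continuous_const hτc).mem_nhds hx] with y hy
    exact hηzero j y (by linarith [show t j / 8 < τ y from hy])
  -- The terms of the series, and their derivatives.
  have hterm := fun j => exists_deriv_cutoff_smul (s := Metric.ball x₀ ρ) (U := {x | τ x < t (j + 1)})
    (η := η j) (Δ := fun x => translateAverage e (t (j + 1)) f x - translateAverage e (t j) f x)
    (Δ' := fun x => translateAverage e (t (j + 1)) f' x - translateAverage e (t j) f' x)
    (Δ'' := fun x => translateAverage e (t (j + 1)) f'' x - translateAverage e (t j) f'' x)
    (hη j) (hη1 j)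
    (fun x _ => by
      by_cases h : τ x < t (j + 1)
      · exact Or.inl h
      · refine Or.inr (hηzero' j x ?_)
        rw [htsucc] at h
        linarith [htpos j])
    (fun x hx => (hA (j + 1) x hx.1 hx.2).1.sub
      (hA j x hx.1 (lt_of_lt_of_le hx.2 (htanti j.le_succ))).1)
    (fun x hx => (hA (j + 1) x hx.1 hx.2).2.1.sub
      (hA j x hx.1 (lt_of_lt_of_le hx.2 (htanti j.le_succ))).2.1)
    (fun x hx => (hA (j + 1) x hx.1 hx.2).2.2.sub
      (hA j x hx.1 (lt_of_lt_of_le hx.2 (htanti j.le_succ))).2.2)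
  choose T' T'' hT hT' hT'' hTone hTzero hTnorm using hterm
  set T : ℕ → E → F := fun j x =>
    η j x • (translateAverage e (t (j + 1)) f x - translateAverage e (t j) f x) with hTdef
  set S : ℕ → E → F := fun N x => translateAverage e (t 0) f x + ∑ j ∈ Finset.range N, T j x with hS
  set S' : ℕ → E → E →L[ℝ] F := fun N x =>
    translateAverage e (t 0) f' x + ∑ j ∈ Finset.range N, T' j x with hS'
  set S'' : ℕ → E → E →L[ℝ] E →L[ℝ] F := fun N x =>
    translateAverage e (t 0) f'' x + ∑ j ∈ Finset.range N, T'' j x with hS''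
  have hτ0 : ∀ x ∈ Metric.ball x₀ ρ, τ x < t 0 := fun x hx => by simpa [ht] using hρτ x hx
  -- On `K` all the cutoffs equal `1`, so that the series telescopes.
  have hSK : ∀ x, τ x ≤ 0 → ∀ N, S N x = translateAverage e (t N) f x := by
    intro x hx N
    have : ∀ j, T j x = translateAverage e (t (j + 1)) f x - translateAverage e (t j) f x := fun j => by
      simp only [hTdef]
      rw [hηone j x (by linarith [htpos j]), one_smul]
    simp only [hS, this]
    rw [Finset.sum_range_sub (fun j => translateAverage e (t j) f x) N, add_sub_cancel]
  have hSK' : ∀ N, S' N x₀ = translateAverage e (t N) f' x₀ := by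
    intro N
    have : ∀ j, T' j x₀ = translateAverage e (t (j + 1)) f' x₀ - translateAverage e (t j) f' x₀ :=
      fun j => (hTone j x₀ (hηone' j x₀ (by linarith [htpos j]))).1
    simp only [hS', this]
    rw [Finset.sum_range_sub (fun j => translateAverage e (t j) f' x₀) N, add_sub_cancel]
  have hKseg : ∀ x ∈ Metric.ball x₀ ρ, τ x ≤ 0 → ∀ j, ∀ s ∈ Set.Icc (t j) (3 * t j),
      x + s • e ∈ D := fun x hx hτx j s hs =>
    hmem x hx s ((htpos j).le.trans hs.1) (hτx.trans ((htpos j).le.trans hs.1))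
      (hs.2.trans (by linarith [htle j]))
  have hKD : ∀ x ∈ Metric.ball x₀ ρ, τ x ≤ 0 → x ∈ D := fun x hx hτx => by
    simpa using hmem x hx 0 le_rfl hτx (by linarith)
  have hlim : ∀ x ∈ Metric.ball x₀ ρ, τ x ≤ 0 →
      Filter.Tendsto (fun N => S N x) Filter.atTop (𝓝 (f x)) := by
    intro x hx hτx
    simp only [hSK x hτx]
    exact tendsto_translateAverage (hf' x (hKD x hx hτx)).continuousWithinAt htlim
      (hKseg x hx hτx) fun j => (htpos j).le
  have hx₀b : x₀ ∈ Metric.ball x₀ ρ := Metric.mem_ball_self hρ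
  have hlim' : Filter.Tendsto (fun N => S' N x₀) Filter.atTop (𝓝 (f' x₀)) := by
    simp only [hSK']
    exact tendsto_translateAverage (hf'' x₀ (hKD x₀ hx₀b hx₀)).continuousWithinAt htlim
      (hKseg x₀ hx₀b hx₀) fun j => (htpos j).le
  -- The second derivatives of the partial sums are uniformly Cauchy.
  set κ := ‖ContinuousLinearMap.smulRightL ℝ E F‖ with hκ
  have hκ0 : 0 ≤ κ := norm_nonneg _
  set c : ℝ := 14 * (1 + (1 + κ) * (C * (48 * ‖e‖)) + κ * (C * (48 * ‖e‖) ^ 2)) with hc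
  have hc14 : 14 ≤ c := by
    have : 0 ≤ (1 + κ) * (C * (48 * ‖e‖)) + κ * (C * (48 * ‖e‖) ^ 2) := by positivity
    rw [hc]
    linarith
  have hcauchy : UniformCauchySeqOn S'' Filter.atTop (Metric.ball x₀ ρ) := by
    rw [Metric.uniformCauchySeqOn_iff]
    intro ε hε
    set ν : ℝ := ε / (3 * c) with hν
    have hν0 : 0 < ν := div_pos hε (by linarith)
    have hcν : 2 * (c * ν) < ε := by
      have h3 : 3 * c * ν = ε := by
        rw [hν]
        field_simp
      have : 0 < c * ν := mul_pos (by linarith) hν0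
      linarith
    obtain ⟨δ, hδ, hosc⟩ := Metric.uniformContinuousOn_iff.1 hunif ν hν0
    obtain ⟨M₀, hM₀⟩ : ∃ M₀, ∀ j, M₀ ≤ j → 3 * t j * ‖e‖ < δ := by
      have h : Filter.Tendsto (fun j => 3 * t j * ‖e‖) Filter.atTop (𝓝 (3 * 0 * ‖e‖)) :=
        (htlim.const_mul 3).mul_const _
      rw [mul_zero, zero_mul] at h
      exact Filter.eventually_atTop.1 (h.eventually_lt_const hδ)
    have hest : ∀ x ∈ Metric.ball x₀ ρ, ∀ m n, M₀ ≤ m → m ≤ n → τ x ≤ t n →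
        ‖translateAverage e (t n) f x - translateAverage e (t m) f x‖ ≤
          14 * (ν * (3 * t m * ‖e‖) ^ 2) ∧
        ‖translateAverage e (t n) f' x - translateAverage e (t m) f' x‖ ≤
          14 * (ν * (3 * t m * ‖e‖)) ∧
        ‖translateAverage e (t n) f'' x - translateAverage e (t m) f'' x‖ ≤ 14 * ν := by
      intro x hx m n hm hmn hτx
      have hseg : ∀ u ∈ Set.Icc (t n) (3 * t m), x + u • e ∈ D := fun u hu =>
        hmem x hx u ((htpos n).le.trans hu.1) (hτx.trans hu.1)
          (hu.2.trans (by linarith [htle m]))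
      have hs : t n ∈ Set.Icc (t n) (3 * t m) := ⟨le_rfl, by linarith [htanti hmn, htpos m]⟩
      refine norm_translateAverage_sub_le hf' hf'' (htpos n).le (htanti hmn) hseg fun u hu => ?_
      rw [← dist_eq_norm]
      refine (hosc _ (hseg u hu) _ (hseg _ hs) ?_).le
      rw [dist_add_left, dist_eq_norm, ← sub_smul, norm_smul,
        Real.norm_of_nonneg (by linarith [hu.1])]
      refine lt_of_le_of_lt (mul_le_mul_of_nonneg_right ?_ hne) (hM₀ m hm)
      linarith [hu.2, htpos n]
    have hTbound : ∀ x ∈ Metric.ball x₀ ρ, ∀ j, M₀ ≤ j → ‖T'' j x‖ ≤ c * ν := by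
      intro x hx j hj
      by_cases hτx : τ x ≤ t (j + 1)
      · obtain ⟨e0, e1, e2⟩ := hest x hx j (j + 1) hj j.le_succ hτx
        have htj := htpos j
        refine (hTnorm j x).trans ?_
        have d1 := hηd j x
        have d2 := hηd' j x
        have m1 := mul_le_mul d1 e1 (norm_nonneg _) (by positivity)
        have m2 := mul_le_mul d2 e0 (norm_nonneg _) (by positivity)
        calc _ ≤ 14 * ν + (1 + κ) * (C / (t j / 16) * (14 * (ν * (3 * t j * ‖e‖)))) +
              κ * (C / (t j / 16) ^ 2 * (14 * (ν * (3 * t j * ‖e‖) ^ 2))) :=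
            add_le_add (add_le_add e2 (mul_le_mul_of_nonneg_left m1 (by positivity)))
              (mul_le_mul_of_nonneg_left m2 hκ0)
          _ = c * ν := by
            rw [hc]
            field_simp
            ring
      · rw [hTzero j x (hηzero' j x ?_), norm_zero]
        · exact mul_nonneg (by linarith) hν0.le
        · rw [htsucc] at hτx
          linarith [htpos j]
    have hle : ∀ m n, M₀ ≤ m → m ≤ n → ∀ x ∈ Metric.ball x₀ ρ, Dist.dist (S'' m x) (S'' n x) < ε := by
      intro m n hm hmn x hx
      have e1 : S'' n x - S'' m x = ∑ j ∈ Finset.Ico m n, T'' j x := by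
        simp only [hS'']
        rw [add_sub_add_left_eq_sub, Finset.sum_Ico_eq_sub _ hmn]
      rw [dist_comm, dist_eq_norm, e1]
      refine (norm_sum_Ico_le_of_telescoping (θ := τ x) (a := fun j => t j / 16)
        (A := fun j => translateAverage e (t j) f'' x)
        (mul_nonneg (by linarith) hν0.le : 0 ≤ c * ν) (fun j => ?_) (fun j _ hj => ?_)
        (fun j hj hτj => ?_) (fun j hj => hTbound x hx j (hm.trans hj)) (fun j hj => ?_)
        n hmn).trans_lt hcν
      · simp only [htsucc]
        linarith [htpos j]
      · exact (hTone j x (hηone' j x hj)).2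
      · refine (hest x hx m (j + 1) hm (by omega) ?_).2.2.trans
          (mul_le_mul_of_nonneg_right hc14 hν0.le)
        rw [htsucc]
        linarith [htpos j]
      · refine hTzero (j + 1) x (hηzero' (j + 1) x ?_)
        rw [htsucc]
        linarith [htpos j]
    refine ⟨M₀, fun m hm n hn x hx => ?_⟩
    rcases le_total m n with h | h
    · exact hle m n hm h x hx
    · rw [dist_comm]
      exact hle n m hn h x hx
  obtain ⟨g, hg, hgl⟩ := exists_contDiffOn_two_of_uniformCauchySeqOn (x₀ := x₀) (ρ := ρ)
    (f := S) (f' := S') (f'' := S'')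
    (fun N x hx => (hA 0 x hx (hτ0 x hx)).1.add (HasFDerivAt.fun_sum fun j _ => hT j x hx))
    (fun N x hx => (hA 0 x hx (hτ0 x hx)).2.1.add (HasFDerivAt.fun_sum fun j _ => hT' j x hx))
    (fun N x hx => ((hA 0 x hx (hτ0 x hx)).2.2.add
      (tendsto_finsetSum _ fun j _ => (hT'' j x hx).tendsto)).continuousWithinAt)
    hcauchy ⟨_, hlim x₀ hx₀b hx₀⟩ ⟨_, hlim'⟩
  refine ⟨g, hg.contDiffAt (Metric.ball_mem_nhds x₀ hρ), ?_⟩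
  filter_upwards [Metric.ball_mem_nhds x₀ hρ] with x hx hτx
  exact tendsto_nhds_unique (hgl x hx) (hlim x hx hτx)

/-! ### Lipschitz border points and slice charts -/

theorem sliceProj_apply {k d : ℕ} (hk : k ≤ d) (y : EuclideanSpace ℝ (Fin d)) (i : Fin k) :
    sliceProj hk y i = y (Fin.castLE hk i) :=
  rfl

/-- Near a Lipschitz boundary point, the closure of a set is the sublevel set `{τ ≤ 0}` of a
Lipschitz function `τ` that decreases at unit speed in some direction. -/
theorem IsLipschitzBoundaryPoint.exists_lipschitz_defining_function {n : ℕ}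
    {Ω : Set (EuclideanSpace ℝ (Fin (n + 1)))} {x : EuclideanSpace ℝ (Fin (n + 1))}
    (h : IsLipschitzBoundaryPoint Ω x) :
    ∃ (τ : EuclideanSpace ℝ (Fin (n + 1)) → ℝ) (L : NNReal) (e : EuclideanSpace ℝ (Fin (n + 1))),
      LipschitzWith L τ ∧ (∀ y (t : ℝ), τ (y + t • e) = τ y - t) ∧
      ∀ᶠ y in 𝓝 x, (y ∈ closure Ω ↔ τ y ≤ 0) := by
  obtain ⟨-, R, γ, δ, hδ, ⟨K, hK⟩, hcl, -⟩ := h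
  let P : EuclideanSpace ℝ (Fin (n + 1)) →L[ℝ] EuclideanSpace ℝ (Fin n) := sliceProj (Nat.le_succ n)
  let l : EuclideanSpace ℝ (Fin (n + 1)) →L[ℝ] ℝ := EuclideanSpace.proj (Fin.last n)
  let v : EuclideanSpace ℝ (Fin (n + 1)) := EuclideanSpace.single (Fin.last n) 1
  have hlv : l v = 1 := by simp [l, v]
  have hPv : P v = 0 := by
    ext i
    have : Fin.castLE (Nat.le_succ n) i ≠ Fin.last n := (Fin.castSucc_lt_last i).ne
    simp [P, v, sliceProj_apply, this]
  refine ⟨fun y => γ (P (R y)) - l (R y), K * (‖P‖₊ * 1) + ‖l‖₊ * 1,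
    R.linearIsometryEquiv.symm v, ?_, fun y t => ?_, ?_⟩
  · exact (hK.comp (P.lipschitz.comp R.lipschitz)).sub (l.lipschitz.comp R.lipschitz)
  · have : R (y + t • R.linearIsometryEquiv.symm v) = t • v + R y := by
      rw [add_comm y]
      simpa [vadd_eq_add] using R.map_vadd y (t • R.linearIsometryEquiv.symm v)
    simp only [this, map_add, map_smul, hPv, hlv, smul_zero, zero_add, smul_eq_mul, mul_one]
    ring
  · have hb : ∀ᶠ y in 𝓝 x, R y ∈ Metric.ball (R x) δ :=
      R.continuous.continuousAt.eventually_mem (Metric.ball_mem_nhds _ hδ)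
    filter_upwards [hb] with y hy
    have h1 : R y ∈ R '' closure Ω ∩ Metric.ball (R x) δ ↔ R y ∈ epigraph γ ∩ Metric.ball (R x) δ := by
      rw [hcl]
    rw [Set.mem_inter_iff, Set.mem_inter_iff, R.injective.mem_set_image] at h1
    rw [sub_nonpos]
    exact ⟨fun hc => (h1.1 ⟨hc, hy⟩).1, fun hc => (h1.2 ⟨hc, hy⟩).1⟩

/-- A function that is `C²` on a set `S`, up to its border points, agrees with a `C²` function
near interior points and near Lipschitz border points of `S`. -/
theorem ContDiffOn.exists_extension_of_interior_or_border {n : ℕ} {F : Type*}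
    [NormedAddCommGroup F] [NormedSpace ℝ F] [CompleteSpace F]
    {S : Set (EuclideanSpace ℝ (Fin (n + 1)))} {x : EuclideanSpace ℝ (Fin (n + 1))} (hx : x ∈ S)
    (hS : x ∈ interior S ∨ (IsLipschitzBoundaryPoint (interior S) x ∧
      ∀ᶠ y in 𝓝 x, (y ∈ S ↔ y ∈ closure (interior S))))
    {f : EuclideanSpace ℝ (Fin (n + 1)) → F} (hf : ContDiffOn ℝ 2 f S) :
    ∃ g : EuclideanSpace ℝ (Fin (n + 1)) → F, ContDiffAt ℝ 2 g x ∧ ∀ᶠ y in 𝓝 x, y ∈ S → g y = f y := by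
  rcases hS with hS | ⟨hS, hcl⟩
  · exact ⟨f, hf.contDiffAt (mem_interior_iff_mem_nhds.1 hS),
      Filter.Eventually.of_forall fun _ _ => rfl⟩
  · obtain ⟨τ, L, e, hL, hτ, hnear⟩ := hS.exists_lipschitz_defining_function
    have hiff : ∀ᶠ y in 𝓝 x, (y ∈ S ↔ τ y ≤ 0) := by
      filter_upwards [hcl, hnear] with y h1 h2
      exact h1.trans h2
    have hset : S =ᶠ[𝓝 x] {y | τ y ≤ 0} := Filter.eventuallyEq_set.2 hiff
    obtain ⟨g, hg, hgf⟩ := ((hf x hx).congr_set hset).exists_extension_of_lipschitz hL hτ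
      (hiff.self_of_nhds.1 hx)
    refine ⟨g, hg, ?_⟩
    filter_upwards [hgf, hiff] with y h1 h2 hy
    exact h1 (h2.1 hy)

section Manifold

variable {d : ℕ} {X : Type*} [TopologicalSpace X] [ChartedSpace (EuclideanSpace ℝ (Fin d)) X]

/-- The inclusion of `ℝᵏ` into `ℝᵈ` as `ℝᵏ × {0}`. -/
noncomputable def sliceIncl (k d : ℕ) : EuclideanSpace ℝ (Fin k) →L[ℝ] EuclideanSpace ℝ (Fin d) :=
  LinearMap.toContinuousLinearMap
    { toFun := fun y => WithLp.toLp 2 fun i => if h : (i : ℕ) < k then y ⟨i, h⟩ else 0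
      map_add' := fun _ _ => by ext i; by_cases h : (i : ℕ) < k <;> simp [h]
      map_smul' := fun _ _ => by ext i; by_cases h : (i : ℕ) < k <;> simp [h] }

theorem sliceIncl_apply {k : ℕ} (y : EuclideanSpace ℝ (Fin k)) (i : Fin d) :
    sliceIncl k d y i = if h : (i : ℕ) < k then y ⟨i, h⟩ else 0 :=
  rfl

theorem sliceProj_sliceIncl {k : ℕ} (hk : k ≤ d) (y : EuclideanSpace ℝ (Fin k)) :
    sliceProj hk (sliceIncl k d y) = y := by
  ext i
  simp [sliceProj_apply, sliceIncl_apply]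

theorem sliceIncl_sliceProj {k : ℕ} (hk : k ≤ d) {y : EuclideanSpace ℝ (Fin d)}
    (hy : ∀ i : Fin d, k ≤ (i : ℕ) → y i = 0) : sliceIncl k d (sliceProj hk y) = y := by
  ext i
  by_cases h : (i : ℕ) < k
  · simp [sliceProj_apply, sliceIncl_apply, h]
  · simp [sliceIncl_apply, h, hy i (not_lt.1 h)]

theorem inner_sliceProj_self_le {k : ℕ} (hk : k ≤ d) (y : EuclideanSpace ℝ (Fin d)) :
    inner ℝ (sliceProj hk y) (sliceProj hk y) ≤ inner ℝ y y := by
  simp only [PiLp.inner_apply]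
  have h := Finset.sum_le_sum_of_subset_of_nonneg
    (Finset.subset_univ (Finset.univ.map (Fin.castLEEmb hk)))
    (f := fun i => inner ℝ (y i) (y i)) (fun i _ _ => real_inner_self_nonneg)
  rw [Finset.sum_map] at h
  exact h

theorem inner_sliceProj {k : ℕ} (hk : k ≤ d) {y z : EuclideanSpace ℝ (Fin d)}
    (hy : ∀ i : Fin d, k ≤ (i : ℕ) → y i = 0) :
    inner ℝ (sliceProj hk y) (sliceProj hk z) = inner ℝ y z := by
  simp only [PiLp.inner_apply]
  have h := Finset.sum_subset (Finset.subset_univ (Finset.univ.map (Fin.castLEEmb hk)))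
    (f := fun i => inner ℝ (y i) (z i)) (fun i _ hi => by
      have : k ≤ (i : ℕ) := by
        by_contra hlt
        refine hi (Finset.mem_map.2 ⟨⟨i, not_le.1 hlt⟩, Finset.mem_univ _, ?_⟩)
        ext
        rfl
      simp [hy i this])
  rw [Finset.sum_map] at h
  exact h

theorem IsLipschitzSliceChart.zero_mem_sliceImage {n : ℕ} {hn : n + 1 ≤ d} {M : Set X} {p : X}
    {φ : OpenPartialHomeomorph X (EuclideanSpace ℝ (Fin d))}
    (h : IsLipschitzSliceChart hn M p φ) (hp : p ∈ M) : 0 ∈ sliceImage hn M φ :=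
  ⟨p, ⟨h.mem_source, hp⟩, by simp [h.map_center]⟩

theorem IsLipschitzSliceChart.zero_mem_closure_interior {n : ℕ} {hn : n + 1 ≤ d} {M : Set X}
    {p : X} {φ : OpenPartialHomeomorph X (EuclideanSpace ℝ (Fin d))}
    (h : IsLipschitzSliceChart hn M p φ) : 0 ∈ closure (interior (sliceImage hn M φ)) := by
  rcases h.interior_or_border with h | h
  · exact subset_closure h
  · exact frontier_subset_closure h.1.1

theorem mdifferentiable_of_mem_maximalAtlas {φ : OpenPartialHomeomorph X (EuclideanSpace ℝ (Fin d))}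
    (hφ : φ ∈ IsManifold.maximalAtlas (𝓡 d) ∞ X) : φ.MDifferentiable (𝓡 d) (𝓡 d) :=
  ⟨(contMDiffOn_of_mem_maximalAtlas hφ).mdifferentiableOn (by simp),
    (contMDiffOn_symm_of_mem_maximalAtlas hφ).mdifferentiableOn (by simp)⟩

/-- Vectors tangent to `M` have vanishing last components in a slice chart: multiply the
components of the chart by a bump function. -/
theorem IsLipschitzSliceChart.mfderiv_apply_eq_zero [IsManifold (𝓡 d) ∞ X] [T2Space X] {n : ℕ} {hn : n + 1 ≤ d}
    {M : Set X} {p : X} {φ : OpenPartialHomeomorph X (EuclideanSpace ℝ (Fin d))}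
    (h : IsLipschitzSliceChart hn M p φ) {x : X} (hx : x ∈ φ.source)
    {u : TangentSpace (𝓡 d) x} (hu : u ∈ tangentSpaceOn (d := d) M x) {i : Fin d}
    (hi : n + 1 ≤ (i : ℕ)) :
    (EuclideanSpace.proj i : EuclideanSpace ℝ (Fin d) →L[ℝ] ℝ) (mfderiv (𝓡 d) (𝓡 d) φ x u) = 0 := by
  obtain ⟨b, -, hb⟩ := (SmoothBumpFunction.nhds_basis_tsupport (I := 𝓡 d) x).mem_iff.1
    (φ.open_source.mem_nhds hx)
  let l : EuclideanSpace ℝ (Fin d) →L[ℝ] ℝ := EuclideanSpace.proj i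
  have hsm : ∀ y ∈ φ.source, ContMDiffAt (𝓡 d) (𝓡 d) ∞ φ y := fun y hy =>
    (contMDiffOn_of_mem_maximalAtlas h.mem_atlas).contMDiffAt (φ.open_source.mem_nhds hy)
  let f : X → ℝ := fun y => b y * l (φ y)
  have hf : ContMDiff (𝓡 d) 𝓘(ℝ, ℝ) ∞ f := by
    refine contMDiff_of_tsupport fun y hy => ?_
    have hy' : y ∈ φ.source := hb (closure_mono (fun z hz => left_ne_zero_of_mul hz) hy)
    exact b.contMDiff.contMDiffAt.mul (l.contMDiff.contMDiffAt.comp y (hsm y hy'))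
  have hf0 : ∀ y ∈ M, f y = 0 := by
    intro y hy
    by_cases hys : y ∈ φ.source
    · have : l (φ y) = 0 := h.map_slice y ⟨hys, hy⟩ i hi
      simp [f, this]
    · have : b y = 0 := by
        by_contra hb0
        exact hys (hb (subset_tsupport _ hb0))
      simp [f, this]
  have key := hu f hf hf0
  have hfe : f =ᶠ[𝓝 x] l ∘ φ := by
    filter_upwards [b.eventuallyEq_one] with y hy
    simp [f, hy]
  rw [hfe.mfderiv_eq, mfderiv_comp x l.mdifferentiableAt
    ((hsm x hx).mdifferentiableAt (by simp)), ContinuousLinearMap.mfderiv_eq] at key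
  exact key

/-- At the centre of a slice chart, every vector whose last components in the chart vanish is
tangent to `M`. At a border point this holds because the derivative of a function that vanishes
on the interior of the slice vanishes there as well, and is continuous. -/
theorem IsLipschitzSliceChart.mem_tangentSpaceOn {n : ℕ} {hn : n + 1 ≤ d}
    {M : Set X} {p : X} {φ : OpenPartialHomeomorph X (EuclideanSpace ℝ (Fin d))}
    (h : IsLipschitzSliceChart hn M p φ) {u : TangentSpace (𝓡 d) p}
    {w : EuclideanSpace ℝ (Fin (n + 1))} (hu : mfderiv (𝓡 d) (𝓡 d) φ p u = sliceIncl (n + 1) d w) :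
    u ∈ tangentSpaceOn (d := d) M p := by
  intro f hf hf0
  let ι := sliceIncl (n + 1) d
  let k : EuclideanSpace ℝ (Fin d) → ℝ := f ∘ φ.symm
  have h0t : (0 : EuclideanSpace ℝ (Fin d)) ∈ φ.target := h.map_center ▸ φ.map_source h.mem_source
  have hsymm0 : φ.symm 0 = p := by rw [← h.map_center, φ.left_inv h.mem_source]
  have hk : ∀ y ∈ φ.target, ContDiffAt ℝ ∞ k y := fun y hy =>
    (hf.contMDiffAt.comp y ((contMDiffOn_symm_of_mem_maximalAtlas h.mem_atlas).contMDiffAt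
      (φ.open_target.mem_nhds hy))).contDiffAt
  have hkι : ContDiffAt ℝ ∞ (k ∘ ι) 0 := by
    refine ContDiffAt.comp 0 ?_ ι.contDiff.contDiffAt
    rw [map_zero]
    exact hk 0 h0t
  have hS : ∀ s ∈ sliceImage hn M φ, (k ∘ ι) s = 0 := by
    rintro _ ⟨x, hx, rfl⟩
    have : ι (sliceProj hn (φ x)) = φ x := sliceIncl_sliceProj hn (h.map_slice x hx)
    simp only [Function.comp_apply, this, k, φ.left_inv hx.1]
    exact hf0 x hx.2
  have hd0 : ∀ s ∈ interior (sliceImage hn M φ), fderiv ℝ (k ∘ ι) s = 0 := by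
    intro s hs
    have : (k ∘ ι) =ᶠ[𝓝 s] fun _ => 0 := by
      filter_upwards [mem_interior_iff_mem_nhds.1 hs] with y hy using hS y hy
    rw [this.fderiv_eq, fderiv_fun_const]
    rfl
  have hcont : ContinuousAt (fderiv ℝ (k ∘ ι)) 0 :=
    (hkι.fderiv_right (m := 0) (by simp)).continuousAt
  have hzero : fderiv ℝ (k ∘ ι) 0 = 0 := by
    have h1 := hcont.continuousWithinAt (s := interior (sliceImage hn M φ)) |>.mem_closure_image
      h.zero_mem_closure_interior
    have h2 : fderiv ℝ (k ∘ ι) '' interior (sliceImage hn M φ) ⊆ {0} := by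
      rintro _ ⟨s, hs, rfl⟩
      exact hd0 s hs
    exact isClosed_singleton.closure_subset_iff.2 h2 h1
  have hchain : fderiv ℝ (k ∘ ι) 0 = (fderiv ℝ k 0).comp ι := by
    rw [fderiv_comp 0 (by rw [map_zero]; exact (hk 0 h0t).differentiableAt (by simp))
      ι.differentiableAt, map_zero, ι.fderiv]
  have hfk : f =ᶠ[𝓝 p] k ∘ φ := by
    filter_upwards [φ.open_source.mem_nhds h.mem_source] with y hy
    simp [k, φ.left_inv hy]
  have hkd : MDifferentiableAt (𝓡 d) 𝓘(ℝ, ℝ) k (φ p) := by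
    rw [h.map_center]
    exact ((hk 0 h0t).differentiableAt (by simp)).mdifferentiableAt
  rw [hfk.mfderiv_eq, mfderiv_comp p hkd
    ((mdifferentiable_of_mem_maximalAtlas h.mem_atlas).mdifferentiableAt h.mem_source)]
  have e1 : mfderiv (𝓡 d) 𝓘(ℝ, ℝ) k (φ p) = fderiv ℝ k 0 := by
    rw [mfderiv_eq_fderiv, h.map_center]
  change mfderiv (𝓡 d) 𝓘(ℝ, ℝ) k (φ p) (mfderiv (𝓡 d) (𝓡 d) φ p u) = 0
  rw [hu, e1]
  exact congrArg (fun A : EuclideanSpace ℝ (Fin (n + 1)) →L[ℝ] ℝ => A w) (hchain.symm.trans hzero)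

end Manifold

/-! ### Extension of the metric near a point -/

/-- Positive definiteness of bilinear forms on a finite-dimensional space is an open condition. -/
theorem ContinuousAt.eventually_pos_of_pos {V Y : Type*} [NormedAddCommGroup V] [NormedSpace ℝ V]
    [FiniteDimensional ℝ V] [TopologicalSpace Y] {B : Y → V →L[ℝ] V →L[ℝ] ℝ} {y₀ : Y}
    (hB : ContinuousAt B y₀) (hpos : ∀ w, w ≠ 0 → 0 < B y₀ w w) :
    ∀ᶠ y in 𝓝 y₀, ∀ w, w ≠ 0 → 0 < B y w w := by
  have : ProperSpace V := FiniteDimensional.proper_real V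
  have h : ∀ᶠ y in 𝓝 y₀, ∀ w ∈ Metric.sphere (0 : V) 1, 0 < B y w w := by
    refine (isCompact_sphere (0 : V) 1).eventually_forall_of_forall_eventually fun w hw => ?_
    have hw0 : w ≠ 0 := ne_zero_of_mem_unit_sphere ⟨w, hw⟩
    have hc : ContinuousAt (fun z : Y × V => B z.1 z.2 z.2) (y₀, w) := by
      have h1 : ContinuousAt (fun z : Y × V => B z.1) (y₀, w) :=
        ContinuousAt.comp (f := Prod.fst) hB continuousAt_fst
      exact (h1.clm_apply continuousAt_snd).clm_apply continuousAt_snd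
    exact hc.eventually (lt_mem_nhds (hpos w hw0))
  filter_upwards [h] with y hy w hw
  have hn : 0 < ‖w‖ := norm_pos_iff.2 hw
  have h1 := hy (‖w‖⁻¹ • w) (by simp [norm_smul, hn.ne'])
  simp only [map_smul, smul_apply, smul_eq_mul] at h1
  have h2 : 0 < ‖w‖⁻¹ := inv_pos.2 hn
  exact pos_of_mul_pos_right (pos_of_mul_pos_right h1 h2.le) h2.le

section Manifold

variable {d : ℕ} {X : Type*} [TopologicalSpace X] [ChartedSpace (EuclideanSpace ℝ (Fin d)) X]

theorem ContMDiffAt.bilinearComp {V W : Type*} [NormedAddCommGroup V] [NormedSpace ℝ V]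
    [NormedAddCommGroup W] [NormedSpace ℝ W] {m : WithTop ℕ∞} {B : X → W →L[ℝ] W →L[ℝ] ℝ}
    {A : X → V →L[ℝ] W} {x : X}
    (hB : ContMDiffAt (𝓡 d) 𝓘(ℝ, W →L[ℝ] W →L[ℝ] ℝ) m B x)
    (hA : ContMDiffAt (𝓡 d) 𝓘(ℝ, V →L[ℝ] W) m A x) :
    ContMDiffAt (𝓡 d) 𝓘(ℝ, V →L[ℝ] V →L[ℝ] ℝ) m (fun x => (B x).bilinearComp (A x) (A x)) x := by
  have h1 := ((ContinuousLinearMap.flipₗᵢ ℝ V W ℝ).contDiff (n := m)).contMDiff.contMDiffAt.comp x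
    (hB.clm_comp hA)
  exact ((ContinuousLinearMap.flipₗᵢ ℝ V V ℝ).contDiff (n := m)).contMDiff.contMDiffAt.comp x
    (h1.clm_comp hA)

/-- The field of bilinear forms on `X` that is the pullback under a chart `φ` of a field `B` of
bilinear forms on `ℝᵈ`. -/
noncomputable def chartPullback (φ : OpenPartialHomeomorph X (EuclideanSpace ℝ (Fin d)))
    (B : EuclideanSpace ℝ (Fin d) → EuclideanSpace ℝ (Fin d) →L[ℝ] EuclideanSpace ℝ (Fin d) →L[ℝ] ℝ)
    (x : X) : TangentSpace (𝓡 d) x →L[ℝ] TangentSpace (𝓡 d) x →L[ℝ] ℝ :=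
  let A : EuclideanSpace ℝ (Fin d) →L[ℝ] EuclideanSpace ℝ (Fin d) := mfderiv (𝓡 d) (𝓡 d) φ x
  (B (φ x)).bilinearComp A A

theorem chartPullback_apply (φ : OpenPartialHomeomorph X (EuclideanSpace ℝ (Fin d)))
    (B : EuclideanSpace ℝ (Fin d) → EuclideanSpace ℝ (Fin d) →L[ℝ] EuclideanSpace ℝ (Fin d) →L[ℝ] ℝ)
    (x : X) (u v : TangentSpace (𝓡 d) x) :
    chartPullback φ B x u v =
      B (φ x) (mfderiv (𝓡 d) (𝓡 d) φ x u) (mfderiv (𝓡 d) (𝓡 d) φ x v) :=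
  rfl

variable [IsManifold (𝓡 d) ∞ X]

theorem contMDiffAt_chartPullback {φ : OpenPartialHomeomorph X (EuclideanSpace ℝ (Fin d))}
    (hφ : φ ∈ IsManifold.maximalAtlas (𝓡 d) ∞ X)
    {B : EuclideanSpace ℝ (Fin d) → EuclideanSpace ℝ (Fin d) →L[ℝ] EuclideanSpace ℝ (Fin d) →L[ℝ] ℝ}
    {x₀ : X} (hx₀ : x₀ ∈ φ.source) (hB : ContDiffAt ℝ 2 B (φ x₀)) :
    ContMDiffAt (𝓡 d)
      ((𝓡 d).prod 𝓘(ℝ, EuclideanSpace ℝ (Fin d) →L[ℝ] EuclideanSpace ℝ (Fin d) →L[ℝ] ℝ)) 2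
      (fun x => (Bundle.TotalSpace.mk'
        (EuclideanSpace ℝ (Fin d) →L[ℝ] EuclideanSpace ℝ (Fin d) →L[ℝ] ℝ) x
        (chartPullback φ B x) : Bundle.TotalSpace
          (EuclideanSpace ℝ (Fin d) →L[ℝ] EuclideanSpace ℝ (Fin d) →L[ℝ] ℝ)
          (fun x : X => TangentSpace (𝓡 d) x →L[ℝ] TangentSpace (𝓡 d) x →L[ℝ] ℝ))) x₀ := by
  have : IsManifold (𝓡 d) 1 X := IsManifold.of_le (n := ∞) (by simp)
  have hφs : ContMDiffAt (𝓡 d) (𝓡 d) ∞ φ x₀ :=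
    (contMDiffOn_of_mem_maximalAtlas hφ).contMDiffAt (φ.open_source.mem_nhds hx₀)
  have hA := hφs.mfderiv_const (m := 2) (by norm_cast)
  have hBφ : ContMDiffAt (𝓡 d) 𝓘(ℝ, EuclideanSpace ℝ (Fin d) →L[ℝ] EuclideanSpace ℝ (Fin d) →L[ℝ] ℝ) 2
      (fun x => B (φ x)) x₀ := hB.contMDiffAt.comp x₀ (hφs.of_le (by norm_cast))
  rw [contMDiffAt_hom_bundle]
  refine ⟨contMDiffAt_id, (hBφ.bilinearComp hA).congr_of_eventuallyEq ?_⟩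
  filter_upwards [(trivializationAt (EuclideanSpace ℝ (Fin d)) (TangentSpace (𝓡 d)) x₀).open_baseSet.mem_nhds
    (FiberBundle.mem_baseSet_trivializationAt' x₀)] with x hx
  ext v w
  rw [inCoordinates_apply_eq₂ hx hx (by simp)]
  have key : ∀ v : EuclideanSpace ℝ (Fin d), inTangentCoordinates (𝓡 d) (𝓡 d) id φ
      (mfderiv (𝓡 d) (𝓡 d) φ) x₀ x v = mfderiv (𝓡 d) (𝓡 d) φ x
        ((trivializationAt (EuclideanSpace ℝ (Fin d)) (TangentSpace (𝓡 d)) x₀).symm x v) := by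
    intro v
    change (trivializationAt (EuclideanSpace ℝ (Fin d)) (TangentSpace (𝓡 d))
      (φ x₀)).continuousLinearMapAt ℝ (φ x) (mfderiv (𝓡 d) (𝓡 d) φ x _) = _
    rw [TangentBundle.continuousLinearMapAt_model_space]
    exact congrArg (mfderiv (𝓡 d) (𝓡 d) φ x) (Bundle.Trivialization.symmL_apply _ hx v)
  rw [ContinuousLinearMap.bilinearComp_apply, key, key]
  simp
  rfl

/-- Every point of `M` has a neighbourhood to which the metric extends. In a slice chart, extend
the coefficients of the metric, symmetrize, and add the standard form on the last coordinates. -/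
theorem IsC2RiemannianMetric.exists_local_extension [T2Space X] {n : ℕ} {hn : n + 1 ≤ d} {M : Set X}
    (hM : IsSubmanifoldWithLipschitzKinks hn M)
    {g : (x : M) → LinearMap.BilinForm ℝ (tangentSpaceOn (d := d) M (x : X))}
    (hg : IsC2RiemannianMetric hn M g) {p : X} (hp : p ∈ M) :
    ∃ U : Set X, IsOpen U ∧ p ∈ U ∧
      ∃ g' : (x : X) → TangentSpace (𝓡 d) x →L[ℝ] TangentSpace (𝓡 d) x →L[ℝ] ℝ,
        IsC2RiemannianMetricOn U g' ∧
        ∀ x : M, (x : X) ∈ U → ∀ u v : tangentSpaceOn (d := d) M (x : X),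
          g' (x : X) (u : TangentSpace (𝓡 d) (x : X)) (v : TangentSpace (𝓡 d) (x : X)) = g x u v := by
  obtain ⟨φ, hφ⟩ := hM p hp
  obtain ⟨G, hG, hgG⟩ := hg.contDiff ⟨p, hp⟩ φ hφ
  have h0S := hφ.zero_mem_sliceImage hp
  obtain ⟨G', hG', hGG'⟩ := hG.exists_extension_of_interior_or_border h0S hφ.interior_or_border
  have hG0 : G' 0 = G 0 := hGG'.self_of_nhds h0S
  let π : EuclideanSpace ℝ (Fin d) →L[ℝ] EuclideanSpace ℝ (Fin (n + 1)) := sliceProj hn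
  have hπ0 : π 0 = 0 := map_zero π
  let Q : EuclideanSpace ℝ (Fin d) →L[ℝ] EuclideanSpace ℝ (Fin d) →L[ℝ] ℝ :=
    innerSL ℝ - (innerSL ℝ).bilinearComp π π
  let B : EuclideanSpace ℝ (Fin d) →
      EuclideanSpace ℝ (Fin d) →L[ℝ] EuclideanSpace ℝ (Fin d) →L[ℝ] ℝ := fun y =>
    (1 / 2 : ℝ) • ((G' (π y)).bilinearComp π π + ((G' (π y)).bilinearComp π π).flip) + Q
  have hBapply : ∀ y v w, B y v w = 1 / 2 * (G' (π y) (π v) (π w) + G' (π y) (π w) (π v)) +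
      (inner ℝ v w - inner ℝ (π v) (π w)) := fun y v w => rfl
  have hB : ContDiffAt ℝ 2 B 0 := by
    have h1 : ContDiffAt ℝ 2 (fun y => G' (π y)) 0 :=
      ContDiffAt.comp 0 (by rw [hπ0]; exact hG') π.contDiff.contDiffAt
    have h2 : ContDiffAt ℝ 2 (fun y => (G' (π y)).bilinearComp π π) 0 :=
      (h1.contMDiffAt.bilinearComp contMDiffAt_const).contDiffAt
    have h3 := ((ContinuousLinearMap.flipₗᵢ ℝ (EuclideanSpace ℝ (Fin d))
      (EuclideanSpace ℝ (Fin d)) ℝ).contDiff (n := 2)).contDiffAt.comp 0 h2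
    exact ((h2.add h3).const_smul (1 / 2 : ℝ)).add contDiffAt_const
  clear_value B
  have hdφ := mdifferentiable_of_mem_maximalAtlas hφ.mem_atlas
  have hpos0 : ∀ w, w ≠ 0 → 0 < B 0 w w := by
    intro w hw
    rw [hBapply, hπ0, hG0]
    have hle := inner_sliceProj_self_le hn w
    have hw' : 0 < inner ℝ w w := real_inner_self_pos.2 hw
    by_cases hπw : π w = 0
    · simpa [hπw] using hw'
    · obtain ⟨u, hu⟩ := (hdφ.mfderiv_surjective hφ.mem_source) (sliceIncl (n + 1) d (π w))
      have hut : u ∈ tangentSpaceOn (d := d) M p := hφ.mem_tangentSpaceOn hu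
      have hne : (⟨u, hut⟩ : tangentSpaceOn (d := d) M p) ≠ 0 := by
        intro h
        have hu0 : u = 0 := congrArg Subtype.val h
        rw [hu0, map_zero] at hu
        apply hπw
        rw [← sliceProj_sliceIncl hn (π w), ← hu]
        exact map_zero _
      have h1 := hg.pos ⟨p, hp⟩ ⟨u, hut⟩ hne
      rw [hgG ⟨p, hp⟩ hφ.mem_source] at h1
      simp only [hu, hφ.map_center, sliceProj_sliceIncl, map_zero] at h1
      have : inner ℝ (π w) (π w) ≤ inner ℝ w w := hle
      linarith
  have hev : ∀ᶠ y in 𝓝 (0 : EuclideanSpace ℝ (Fin d)), ContDiffAt ℝ 2 B y ∧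
      (∀ w, w ≠ 0 → 0 < B y w w) ∧ (π y ∈ sliceImage hn M φ → G' (π y) = G (π y)) := by
    refine (hB.eventually (by simp)).and ((hB.continuousAt.eventually_pos_of_pos hpos0).and ?_)
    have hc : Filter.Tendsto π (𝓝 0) (𝓝 0) := by
      simpa [hπ0] using π.continuous.tendsto 0
    exact hc.eventually hGG'
  obtain ⟨V, hV, hVo, h0V⟩ := eventually_nhds_iff.1 hev
  refine ⟨φ.source ∩ φ ⁻¹' V, φ.isOpen_inter_preimage hVo,
    ⟨hφ.mem_source, by simpa [hφ.map_center] using h0V⟩, chartPullback φ B, ⟨?_, ?_, ?_⟩, ?_⟩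
  · intro x _ u v
    have hs : ∀ y v w, B y v w = B y w v := fun y v w => by
      rw [hBapply, hBapply, real_inner_comm, real_inner_comm (π w)]
      ring
    exact hs _ _ _
  · intro x hx u hu
    rw [chartPullback_apply]
    refine (hV _ hx.2).2.1 _ fun h => hu ?_
    exact (hdφ.mfderiv_injective hx.1) (h.trans (map_zero _).symm)
  · intro x hx
    exact (contMDiffAt_chartPullback hφ.mem_atlas hx.1 (hV _ hx.2).1).contMDiffWithinAt
  · intro x hx u v
    have hS : π (φ x) ∈ sliceImage hn M φ := ⟨x, ⟨hx.1, x.2⟩, rfl⟩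
    have hB' : ∀ a b : EuclideanSpace ℝ (Fin d), (∀ i : Fin d, n + 1 ≤ (i : ℕ) → a i = 0) →
        ∀ c : ℝ, c = G (π (φ x)) (π a) (π b) → c = G (π (φ x)) (π b) (π a) → B (φ x) a b = c := by
      intro a b ha c h1 h2
      have hin : inner ℝ (π a) (π b) = inner ℝ a b := inner_sliceProj hn ha
      rw [hBapply, (hV _ hx.2).2.2 hS, hin, sub_self, add_zero, ← h1, ← h2]
      ring
    exact hB' _ _ (fun i hi => hφ.mfderiv_apply_eq_zero hx.1 u.2 hi) (g x u v) (hgG x hx.1 u v)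
      ((hg.symm x u v).trans (hgG x hx.1 v u))

end Manifold

/-! ### Components of paracompact spaces and gluing -/

/-- The connected components of a paracompact, locally compact Hausdorff space are `σ`-compact:
starting from a point, the members of a locally finite cover by relatively compact open sets that
are reached by finite chains of intersecting members have a clopen union. -/
theorem isSigmaCompact_connectedComponent {X : Type*} [TopologicalSpace X] [T2Space X]
    [ParacompactSpace X] [LocallyCompactSpace X] (x : X) :
    IsSigmaCompact (connectedComponent x) := by
  choose K hK hKx using fun y : X => exists_compact_mem_nhds y
  obtain ⟨V, hVo, hVc, hVf, hVK⟩ := precise_refinement (fun y => interior (K y))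
    (fun y => isOpen_interior)
    (Set.iUnion_eq_univ_iff.2 fun y => ⟨y, mem_interior_iff_mem_nhds.2 (hKx y)⟩)
  have hcomp : ∀ y, IsCompact (closure (V y)) := fun y =>
    (hK y).closure_of_subset ((hVK y).trans interior_subset)
  let J : ℕ → Set X := fun m => Nat.rec {i | x ∈ V i}
    (fun _ J => {j | (V j ∩ ⋃ i ∈ J, closure (V i)).Nonempty}) m
  have hJ : ∀ m, (J m).Finite := by
    intro m
    induction m with
    | zero => exact hVf.point_finite x
    | succ m ih =>
      exact hVf.finite_nonempty_inter_compact (ih.isCompact_biUnion fun i _ => hcomp i)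
  let U : Set X := ⋃ m, ⋃ i ∈ J m, V i
  have hxU : x ∈ U := by
    obtain ⟨i, hi⟩ := Set.iUnion_eq_univ_iff.1 hVc x
    exact Set.mem_iUnion.2 ⟨0, Set.mem_biUnion (show i ∈ J 0 from hi) hi⟩
  have hUo : IsOpen U := isOpen_iUnion fun m => isOpen_biUnion fun i _ => hVo i
  have hUc : IsClosed U := by
    rw [← isOpen_compl_iff, isOpen_iff_mem_nhds]
    intro y hy
    obtain ⟨j, hj⟩ := Set.iUnion_eq_univ_iff.1 hVc y
    filter_upwards [(hVo j).mem_nhds hj] with z hz hzU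
    obtain ⟨m, hm⟩ := Set.mem_iUnion.1 hzU
    obtain ⟨i, hi, hzi⟩ := Set.mem_iUnion₂.1 hm
    refine hy (Set.mem_iUnion.2 ⟨m + 1, Set.mem_biUnion (show j ∈ J (m + 1) from ?_) hj⟩)
    exact ⟨z, hz, Set.mem_biUnion hi (subset_closure hzi)⟩
  have hσ : IsSigmaCompact (⋃ m, ⋃ i ∈ J m, closure (V i)) :=
    isSigmaCompact_iUnion_of_isCompact _ fun m => (hJ m).isCompact_biUnion fun i _ => hcomp i
  refine hσ.of_isClosed_subset isClosed_connectedComponent ?_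
  refine (IsClopen.connectedComponent_subset ⟨hUc, hUo⟩ hxU).trans ?_
  exact Set.iUnion_mono fun m => Set.iUnion₂_mono fun i _ => subset_closure

theorem secondCountableTopology_of_subset_connectedComponent (d : ℕ) {X : Type*}
    [TopologicalSpace X] [ChartedSpace (EuclideanSpace ℝ (Fin d)) X] [T2Space X]
    [ParacompactSpace X] {x : X} {W : Set X} (hW : W ⊆ connectedComponent x) : SecondCountableTopology W := by
  have : LocallyConnectedSpace X :=
    ChartedSpace.locallyConnectedSpace (EuclideanSpace ℝ (Fin d)) X
  have : LocallyCompactSpace X := Manifold.locallyCompact_of_finiteDimensional (𝓡 d)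
  let C : TopologicalSpace.Opens X := ⟨connectedComponent x, isOpen_connectedComponent⟩
  have : SigmaCompactSpace C :=
    isSigmaCompact_iff_sigmaCompactSpace.1 (isSigmaCompact_connectedComponent x)
  have : SecondCountableTopology C :=
    ChartedSpace.secondCountable_of_sigmaCompact (EuclideanSpace ℝ (Fin d)) C
  exact (Topology.IsEmbedding.inclusion hW).secondCountableTopology

section Manifold

variable {d : ℕ} {X : Type*} [TopologicalSpace X] [ChartedSpace (EuclideanSpace ℝ (Fin d)) X]

variable [IsManifold (𝓡 d) ∞ X]

/-- Local extensions of a metric on `M` are glued by a partition of unity, since a convex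
combination of extensions is an extension. -/
theorem exists_metric_extension_of_local [T2Space X] {M : Set X}
    {g : (x : M) → LinearMap.BilinForm ℝ (tangentSpaceOn (d := d) M (x : X))}
    (W : TopologicalSpace.Opens X) [SecondCountableTopology W]
    (hloc : ∀ p ∈ W, ∃ U : Set X, IsOpen U ∧ p ∈ U ∧
      ∃ g' : (x : X) → TangentSpace (𝓡 d) x →L[ℝ] TangentSpace (𝓡 d) x →L[ℝ] ℝ,
        IsC2RiemannianMetricOn U g' ∧
        ∀ x : M, (x : X) ∈ U → ∀ u v : tangentSpaceOn (d := d) M (x : X),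
          g' (x : X) (u : TangentSpace (𝓡 d) (x : X)) (v : TangentSpace (𝓡 d) (x : X)) = g x u v) :
    ∃ g' : (x : X) → TangentSpace (𝓡 d) x →L[ℝ] TangentSpace (𝓡 d) x →L[ℝ] ℝ,
      IsC2RiemannianMetricOn (W : Set X) g' ∧
      ∀ x : M, (x : X) ∈ W → ∀ u v : tangentSpaceOn (d := d) M (x : X),
        g' (x : X) (u : TangentSpace (𝓡 d) (x : X)) (v : TangentSpace (𝓡 d) (x : X)) = g x u v := by
  classical
  have : LocallyCompactSpace W := Manifold.locallyCompact_of_finiteDimensional (𝓡 d)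
  choose U hUo hU γ hγ hγg using fun p : W => hloc p p.2
  obtain ⟨ρ, hρ⟩ := SmoothPartitionOfUnity.exists_isSubordinate (𝓡 d) (isClosed_univ (X := W))
    (fun p : W => Subtype.val ⁻¹' U p) (fun p => (hUo p).preimage continuous_subtype_val)
    (fun p _ => Set.mem_iUnion.2 ⟨p, hU p⟩)
  let r : W → X → ℝ := fun i x => if h : x ∈ W then ρ i ⟨x, h⟩ else 0
  have hr : ∀ i (x : W), r i x = ρ i x := fun i x => by simp [r]
  let g' : (x : X) → TangentSpace (𝓡 d) x →L[ℝ] TangentSpace (𝓡 d) x →L[ℝ] ℝ := fun x =>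
    ∑ᶠ i, r i x • γ i x
  have hsum : ∀ (x : W) (I : Finset W), ρ.finsupport x ⊆ I → g' x = ∑ i ∈ I, r i x • γ i x := by
    intro x I hI
    refine finsum_eq_sum_of_support_subset _ fun i hi => hI ?_
    rw [SmoothPartitionOfUnity.mem_finsupport, Function.mem_support, ← hr]
    exact left_ne_zero_of_smul hi
  have happly : ∀ (x : W) (u v : TangentSpace (𝓡 d) (x : X)),
      g' x u v = ∑ i ∈ ρ.finsupport x, ρ i x * γ i x u v := by
    intro x u v
    rw [hsum x _ subset_rfl]
    simp [sum_apply, hr]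
  have hmem : ∀ (x : W), ∀ i ∈ ρ.finsupport x, (x : X) ∈ U i := by
    intro x i hi
    rw [SmoothPartitionOfUnity.mem_finsupport] at hi
    exact hρ i (subset_closure hi)
  refine ⟨g', ⟨fun x hx u v => ?_, fun x hx u hu => ?_, fun x hx => ?_⟩, fun x hx u v => ?_⟩
  · rw [happly ⟨x, hx⟩, happly ⟨x, hx⟩]
    exact Finset.sum_congr rfl fun i hi => by rw [(hγ i).symm x (hmem ⟨x, hx⟩ i hi)]
  · rw [happly ⟨x, hx⟩]
    obtain ⟨i, hi⟩ := ρ.exists_pos_of_mem (Set.mem_univ (⟨x, hx⟩ : W))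
    refine Finset.sum_pos' (fun j hj => mul_nonneg (ρ.nonneg _ _)
      ((hγ j).pos x (hmem ⟨x, hx⟩ j hj) u hu).le) ⟨i, ?_, ?_⟩
    · rw [SmoothPartitionOfUnity.mem_finsupport]
      exact hi.ne'
    · refine mul_pos hi ((hγ i).pos x ?_ u hu)
      refine hmem ⟨x, hx⟩ i ?_
      rw [SmoothPartitionOfUnity.mem_finsupport]
      exact hi.ne'
  · refine ContMDiffAt.contMDiffWithinAt ?_
    have hterm : ∀ i ∈ ρ.fintsupport ⟨x, hx⟩, ContMDiffAt (𝓡 d)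
        ((𝓡 d).prod 𝓘(ℝ, EuclideanSpace ℝ (Fin d) →L[ℝ] EuclideanSpace ℝ (Fin d) →L[ℝ] ℝ)) 2
        (fun y => (Bundle.TotalSpace.mk'
          (EuclideanSpace ℝ (Fin d) →L[ℝ] EuclideanSpace ℝ (Fin d) →L[ℝ] ℝ) y
          (r i y • γ i y) : Bundle.TotalSpace
            (EuclideanSpace ℝ (Fin d) →L[ℝ] EuclideanSpace ℝ (Fin d) →L[ℝ] ℝ)
            (fun x : X => TangentSpace (𝓡 d) x →L[ℝ] TangentSpace (𝓡 d) x →L[ℝ] ℝ))) x := by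
      intro i hi
      have hxi : x ∈ U i := hρ i ((ρ.mem_fintsupport_iff _ i).1 hi)
      have hri : ContMDiffAt (𝓡 d) 𝓘(ℝ, ℝ) 2 (r i) x := by
        refine (contMDiffAt_subtype_iff (x := (⟨x, hx⟩ : W))).1 ?_
        have h2 : ContMDiff (𝓡 d) 𝓘(ℝ, ℝ) 2 (ρ i) := (ρ i).contMDiff.of_le (by norm_cast)
        exact h2.contMDiffAt.congr_of_eventuallyEq (Filter.Eventually.of_forall fun y => hr i y)
      exact hri.smul_section (((hγ i).contMDiffOn x hxi).contMDiffAt ((hUo i).mem_nhds hxi))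
    refine (ContMDiffAt.sum_section hterm).congr_of_eventuallyEq ?_
    have hev := ρ.eventually_finsupport_subset (⟨x, hx⟩ : W)
    have hmap : Filter.map Subtype.val (𝓝 (⟨x, hx⟩ : W)) = 𝓝 x :=
      W.isOpen.isOpenEmbedding_subtypeVal.map_nhds_eq ⟨x, hx⟩
    rw [← hmap]
    refine Filter.eventually_map.2 ?_
    filter_upwards [hev] with y hy
    rw [hsum y _ hy]
  · rw [happly ⟨x, hx⟩, ← one_mul (g x u v), ← ρ.sum_finsupport ⟨x, hx⟩ (Set.mem_univ _),
      Finset.sum_mul]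
    exact Finset.sum_congr rfl fun i hi => by rw [hγg i x (hmem ⟨x, hx⟩ i hi)]

end Manifold

theorem mainTheorem9 {d n : ℕ} (hn : n + 1 ≤ d)
    {X : Type*} [TopologicalSpace X] [T2Space X] [ParacompactSpace X]
    [ChartedSpace (EuclideanSpace ℝ (Fin d)) X] [IsManifold (𝓡 d) ∞ X]
    (M : Set X) (hM : IsSubmanifoldWithLipschitzKinks hn M)
    (g : (x : M) → LinearMap.BilinForm ℝ (tangentSpaceOn (d := d) M (x : X)))
    (hg : IsC2RiemannianMetric hn M g) :
    ∃ O : Set X, IsOpen O ∧ M ⊆ O ∧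
      ∃ g' : (x : X) → TangentSpace (𝓡 d) x →L[ℝ] TangentSpace (𝓡 d) x →L[ℝ] ℝ,
        IsC2RiemannianMetricOn O g' ∧
        ∀ (x : M) (u v : tangentSpaceOn (d := d) M (x : X)),
          g' (x : X) (u : TangentSpace (𝓡 d) (x : X)) (v : TangentSpace (𝓡 d) (x : X)) = g x u v := by
  have : LocallyConnectedSpace X :=
    ChartedSpace.locallyConnectedSpace (EuclideanSpace ℝ (Fin d)) X
  choose U hUo hU γ hγ hγg using fun p : M => hg.exists_local_extension hM p.2
  let O : Set X := ⋃ p, U p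
  have hO : IsOpen O := isOpen_iUnion hUo
  have hcomp : ∀ c : ConnectedComponents X, IsOpen ((↑) ⁻¹' {c} : Set X) := by
    intro c
    obtain ⟨x, rfl⟩ := ConnectedComponents.surjective_coe c
    rw [connectedComponents_preimage_singleton]
    exact isOpen_connectedComponent
  -- The second countable pieces `O ∩ C`, for the connected components `C`, are treated separately.
  have hpiece : ∀ c : ConnectedComponents X,
      ∃ g' : (x : X) → TangentSpace (𝓡 d) x →L[ℝ] TangentSpace (𝓡 d) x →L[ℝ] ℝ,
        IsC2RiemannianMetricOn (O ∩ (↑) ⁻¹' {c}) g' ∧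
        ∀ x : M, (x : X) ∈ O ∩ (↑) ⁻¹' {c} → ∀ u v : tangentSpaceOn (d := d) M (x : X),
          g' (x : X) (u : TangentSpace (𝓡 d) (x : X)) (v : TangentSpace (𝓡 d) (x : X)) = g x u v := by
    intro c
    let W : TopologicalSpace.Opens X := ⟨O ∩ (↑) ⁻¹' {c}, hO.inter (hcomp c)⟩
    have : SecondCountableTopology W := by
      obtain ⟨x, rfl⟩ := ConnectedComponents.surjective_coe c
      refine secondCountableTopology_of_subset_connectedComponent d (x := x) ?_
      rw [← connectedComponents_preimage_singleton]
      exact Set.inter_subset_right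
    refine exists_metric_extension_of_local W fun p hp => ?_
    obtain ⟨q, hq⟩ := Set.mem_iUnion.1 hp.1
    exact ⟨U q, hUo q, hq, γ q, hγ q, hγg q⟩
  choose G hG hGg using hpiece
  have hmem : ∀ x ∈ O, x ∈ O ∩ (↑) ⁻¹' {(x : ConnectedComponents X)} := fun x hx => ⟨hx, rfl⟩
  refine ⟨O, hO, fun x hx => Set.mem_iUnion.2 ⟨⟨x, hx⟩, hU ⟨x, hx⟩⟩, fun x => G x x,
    ⟨fun x hx => (hG x).symm x (hmem x hx), fun x hx => (hG x).pos x (hmem x hx), fun x hx => ?_⟩,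
    fun x => hGg x x (hmem x (Set.mem_iUnion.2 ⟨x, hU x⟩))⟩
  refine ContMDiffAt.contMDiffWithinAt ?_
  refine (((hG x).contMDiffOn x (hmem x hx)).contMDiffAt
    ((hO.inter (hcomp x)).mem_nhds (hmem x hx))).congr_of_eventuallyEq ?_
  filter_upwards [(hcomp x).mem_nhds rfl] with y (hy : (y : ConnectedComponents X) = x)
  rw [hy]
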